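/- **Notation.** For $|p_i|<1$ let $(z;p_1,\dots,p_m)_\infty=\prod_{n_1,\dots,n_m\ge 0}(1-z\,p_1^{n_1}\cdots p_m^{n_m})$ and $\Theta_p(z)=(z;p)_\infty(pz^{-1};p)_\infty(p;p)_\infty$. For $x,\omega_1,\dots,\omega_m\in\mathbb C$ with $\operatorname{Re}\omega_i>0$ let $$\Gamma_m(x\,|\,\omega_1,\dots,\omega_m)=\exp\Big(\frac{\partial}{\partial t}\sum_{n_1,\dots,n_m\ge0}(x+n_1\omega_1+\dots+n_m\omega_m)^{-t}\Big|_{t=0}\Big)$$ (the sum is analytically continued in $t$; $1/\Gamma_m:=0$ at the poles $x=-(n_1\omega_1+\dots+n_m\omega_m)$ of $\Gamma_m$), and let $S_2(x|\omega_1,\omega_2)=\Gamma_2(\omega_1+\omega_2-x|\omega_1,\omega_2)/\Gamma_2(x|\omega_1,\omega_2)$ be the double sine function. For scalars put $$M(\rho;b,c,\bar c,\bar b)=\rho\begin{pmatrix}1&0&0&0\\0&b&c&0\\0&\bar c&\bar b&0\\0&0&0&1\end{pmatrix}$$ in the basis $(++),(+-),(-+),(--)$ of $\mathbb C^2\otimes\mathbb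 C^2$. The face elliptic $R$-matrix of ${\cal B}_{q,p,\lambda}(\widehat{sl}(2))$ is $R(z;p,w)=M(\rho(z;p);b(z),c(z),\bar c(z),\bar b(z))$ with $$b(z)=q\frac{(pw^{-1}q^2;p)_\infty(pw^{-1}q^{-2};p)_\infty}{(pw^{-1};p)_\infty^2}\frac{\Theta_p(z)}{\Theta_p(q^2z)},\qquad \bar b(z)=q\frac{(wq^2;p)_\infty(wq^{-2};p)_\infty}{(w;p)_\infty^2}\frac{\Theta_p(z)}{\Theta_p(q^2z)},$$ $$c(z)=\frac{\Theta_p(q^2)\,\Theta_p(wz)}{\Theta_p(w)\,\Theta_p(q^2z)},\qquad \bar c(z)=z\,\frac{\Theta_p(q^2)\,\Theta_p(pw^{-1}z)}{\Theta_p(pw^{-1})\,\Theta_p(q^2z)},$$ $$\rho(z;p)=q^{-1/2}\frac{(q^2z;p,q^4)_\infty^2}{(z;p,q^4)_\infty(q^4z;p,q^4)_\infty}\,\frac{(pz^{-1};p,q^4)_\infty(pq^4z^{-1};p,q^4)_\infty}{(pq^2z^{-1};p,q^4)_\infty^2}.$$ The $R$-matrix of the dynamical deformed double Yangian ${\cal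 D}Y_{r,s}$ is $R(\beta;r,s)=M(\rho(\beta;r);b(\beta),c(\beta),\bar c(\beta),\bar b(\beta))$ with $$b(\beta)=\frac{\Gamma_1(r-s|r)^2}{\Gamma_1(r-s+1|r)\Gamma_1(r-s-1|r)}\,\frac{\sin\frac{i\beta}{r}}{\sin\frac{\pi+i\beta}{r}},\qquad \bar b(\beta)=\frac{\Gamma_1(s|r)^2}{\Gamma_1(s+1|r)\Gamma_1(s-1|r)}\,\frac{\sin\frac{i\beta}{r}}{\sin\frac{\pi+i\beta}{r}},$$ $$c(\beta)=\frac{\sin\frac{\pi s+i\beta}{r}}{\sin\frac{\pi s}{r}}\frac{\sin\frac{\pi}{r}}{\sin\frac{\pi+i\beta}{r}},\qquad \bar c(\beta)=\frac{\sin\frac{\pi s-i\beta}{r}}{\sin\frac{\pi s}{r}}\frac{\sin\frac{\pi}{r}}{\sin\frac{\pi+i\beta}{r}},\qquad \rho(\beta;r)=\frac{S_2(1+\frac{i\beta}{\pi}|r,2)^2}{S_2(\frac{i\beta}{\pi}|r,2)\,S_2(2+\frac{i\beta}{\pi}|r,2)}.$$ **Statement.** Let $r\in\mathbb C$ with $\operatorname{Re}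 r>0$. 1. (Scaling limit.) Let $\beta,s\in\mathbb C$ be such that $\sin\frac{\pi+i\beta}{r}\ne0$, $\sin\frac{\pi s}{r}\neq0$ and, for all integers $m,n\ge0$, $\frac{i\beta}\pi+mr+2n\neq0$ and $r+1-\frac{i\beta}\pi+mr+2n\ne0$ (so that no denominator of $R(\beta;r,s)$ degenerates). Then, entry by entry, $$\lim_{q\to1,\;0<q<1}R(z;p,w)\Big|_{p=q^{2r},\,z=q^{2i\beta/\pi},\,w=q^{2s}}=R(\beta;r,s).$$ 2. (Normalization.) If $\beta$ satisfies $\sin(i\beta)\ne0$ and the last two conditions of 1, then $$\rho(\beta;r)=-\frac{S_2(-\frac{i\beta}{\pi}|r,2)\,S_2(1+\frac{i\beta}{\pi}|r,2)}{S_2(\frac{i\beta}{\pi}|r,2)\,S_2(1-\frac{i\beta}{\pi}|r,2)}\cot\frac{i\beta}{2}.$$ 3. (Dynamical Yang–Baxter equation.) For all $\beta,\beta',s\in\mathbb C$ such that $\sin\frac{\pi+i\beta}r$, $\sin\frac{\pi+i\beta'}r$, $\sin\frac{\pi+i(\beta+\beta')}r$, $\sin\frac{\pi s}r$, $\sin\frac{\pi(s+1)}r$,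 $\sin\frac{\pi(s-1)}r$ are all nonzero (and the normalization factors $\rho(\beta;r),\rho(\beta';r),\rho(\beta+\beta';r)$ are finite), one has on $\mathbb C^2\otimes\mathbb C^2\otimes\mathbb C^2$ $$R_{12}(\beta;s+h^{(3)})\,R_{13}(\beta+\beta';s)\,R_{23}(\beta';s+h^{(1)})=R_{23}(\beta';s)\,R_{13}(\beta+\beta';s+h^{(2)})\,R_{12}(\beta;s),$$ where $R(\beta;s)=R(\beta;r,s)$, $h=\operatorname{diag}(1,-1)$ and $h^{(j)}$ is $h$ acting on the $j$-th factor. -/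

import Mathlib

open Filter Topology

noncomputable section

namespace DynYangian

/-! ### Infinite products and theta functions -/

/-- The infinite multiple product `(z; p₁, …, pₘ)_∞ = ∏_{n₁, …, nₘ ≥ 0} (1 - z p₁^{n₁} ⋯ pₘ^{nₘ})`
(meaningful when all `|pᵢ| < 1`). -/
def qProd {m : ℕ} (z : ℂ) (p : Fin m → ℂ) : ℂ :=
  ∏' n : Fin m → ℕ, (1 - z * ∏ i, p i ^ n i)

/-- `Θ_p(z) = (z; p)_∞ (p z⁻¹; p)_∞ (p; p)_∞`. -/
def theta (p z : ℂ) : ℂ :=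
  qProd z ![p] * qProd (p * z⁻¹) ![p] * qProd p ![p]

/-! ### Barnes multiple gamma functions and the double sine function -/

/-- `Z` is the analytic continuation, to `ℂ` minus the possible poles `1, …, m`, of the Barnes
zeta series `s ↦ ∑_{n₁, …, nₘ ≥ 0} (x + n₁ ω₁ + ⋯ + nₘ ωₘ)^{-s}`, which converges absolutely for
`Re s > m` when the periods lie in the open right half-plane. -/
def IsBarnesZeta {m : ℕ} (x : ℂ) (ω : Fin m → ℂ) (Z : ℂ → ℂ) : Prop :=
  AnalyticOnNhd ℂ Z {s : ℂ | ∀ k : ℕ, 1 ≤ k → k ≤ m → s ≠ (k : ℂ)} ∧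
    ∀ s : ℂ, (m : ℝ) < s.re →
      Z s = ∑' n : Fin m → ℕ, (x + ∑ i, (n i : ℂ) * ω i) ^ (-s)

/-- The continuation is unique, so the derivative at `0` used below is well defined. -/
theorem IsBarnesZeta.eqOn {m : ℕ} {x : ℂ} {ω : Fin m → ℂ} {Z W : ℂ → ℂ}
    (hZ : IsBarnesZeta x ω Z) (hW : IsBarnesZeta x ω W) :
    Set.EqOn Z W {s : ℂ | ∀ k : ℕ, 1 ≤ k → k ≤ m → s ≠ (k : ℂ)} := by
  have hset : {s : ℂ | ∀ k : ℕ, 1 ≤ k → k ≤ m → s ≠ (k : ℂ)} =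
      ((fun k : ℕ => (k : ℂ)) '' {k : ℕ | 1 ≤ k ∧ k ≤ m})ᶜ := by
    ext s
    simp only [Set.mem_ofPred_eq, Set.mem_compl_iff, Set.mem_image, not_exists, not_and]
    exact ⟨fun h k hk e => h k hk.1 hk.2 e.symm, fun h k h1 h2 e => h k ⟨h1, h2⟩ e.symm⟩
  have hconn : IsPreconnected {s : ℂ | ∀ k : ℕ, 1 ≤ k → k ≤ m → s ≠ (k : ℂ)} := by
    rw [hset]
    refine (Set.Countable.isPathConnected_compl_of_one_lt_rank ?_ ?_).isConnected.isPreconnected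
    · rw [Complex.rank_real_complex]
      exact_mod_cast Nat.one_lt_two
    · exact (Set.to_countable _).image _
  have hre : ((m + 1 : ℕ) : ℂ) ∈ {s : ℂ | (m : ℝ) < s.re} := by simp
  refine hZ.1.eqOn_of_preconnected_of_eventuallyEq hW.1 hconn (z₀ := ((m + 1 : ℕ) : ℂ)) ?_ ?_
  · intro k _ h2 h3
    have := Nat.cast_injective (R := ℂ) h3
    omega
  · have hopen : IsOpen {s : ℂ | (m : ℝ) < s.re} :=
      isOpen_lt continuous_const Complex.continuous_re
    filter_upwards [hopen.mem_nhds hre] with s hs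
    rw [hZ.2 s hs, hW.2 s hs]

open Classical in
/-- The multiple gamma function `Γ_m(x | ω₁, …, ωₘ) = exp (∂/∂s ζ_m(s, x | ω) at s = 0)`, where
`ζ_m` is the continued Barnes zeta function.  At its poles `x = -(n₁ ω₁ + ⋯ + nₘ ωₘ)` it has the
value `0`, the same convention as for `Complex.Gamma`; in particular `1 / Γ_m`, which is entire,
has its true value `0` there. -/
def multipleGamma {m : ℕ} (x : ℂ) (ω : Fin m → ℂ) : ℂ :=
  if ∃ n : Fin m → ℕ, x + ∑ i, (n i : ℂ) * ω i = 0 then 0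
  else if h : ∃ Z : ℂ → ℂ, IsBarnesZeta x ω Z then Complex.exp (deriv h.choose 0)
  else 0

/-- Away from the poles, `multipleGamma` may be computed from any continuation. -/
theorem multipleGamma_eq {m : ℕ} {x : ℂ} {ω : Fin m → ℂ} {Z : ℂ → ℂ}
    (hx : ∀ n : Fin m → ℕ, x + ∑ i, (n i : ℂ) * ω i ≠ 0) (hZ : IsBarnesZeta x ω Z) :
    multipleGamma x ω = Complex.exp (deriv Z 0) := by
  classical
  have hex : ∃ Z : ℂ → ℂ, IsBarnesZeta x ω Z := ⟨Z, hZ⟩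
  have hcl : IsClosed ((fun k : ℕ => (k : ℂ)) '' {k : ℕ | 1 ≤ k ∧ k ≤ m}) :=
    (((Set.finite_Icc 1 m).subset fun k hk => hk).image _).isClosed
  have hev : hex.choose =ᶠ[𝓝 0] Z := by
    have h0 : (0 : ℂ) ∈ ((fun k : ℕ => (k : ℂ)) '' {k : ℕ | 1 ≤ k ∧ k ≤ m})ᶜ := by
      rintro ⟨k, hk, h⟩
      have h1 : (k : ℂ) = 0 := h
      have h2 : k = 0 := by exact_mod_cast h1
      have h3 := hk.1
      omega
    filter_upwards [hcl.isOpen_compl.mem_nhds h0] with s hs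
    exact hex.choose_spec.eqOn hZ fun k h1 h2 e => hs ⟨k, ⟨h1, h2⟩, e.symm⟩
  rw [multipleGamma, if_neg (by simpa using hx), dif_pos hex, hev.deriv_eq]

/-- `Γ₁(x | ω)`. -/
def gamma1 (x ω : ℂ) : ℂ := multipleGamma x ![ω]

/-- `Γ₂(x | ω₁, ω₂)`. -/
def gamma2 (x ω₁ ω₂ : ℂ) : ℂ := multipleGamma x ![ω₁, ω₂]

/-- Barnes' double sine function `S₂(x | ω₁, ω₂) = Γ₂(ω₁ + ω₂ - x | ω₁, ω₂) / Γ₂(x | ω₁, ω₂)`. -/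
def doubleSine (x ω₁ ω₂ : ℂ) : ℂ := gamma2 (ω₁ + ω₂ - x) ω₁ ω₂ / gamma2 x ω₁ ω₂

/-! ### The matrices -/

/-- The `4 × 4` matrix, in the basis `(+,+), (+,-), (-,+), (-,-)` of `ℂ² ⊗ ℂ²`, with middle block
`b, c; c', b'` and overall factor `ρ`; the indices `+, -` are `0, 1 : Fin 2`. -/
def faceMatrix (ρ b c c' b' : ℂ) : Matrix (Fin 2 × Fin 2) (Fin 2 × Fin 2) ℂ :=
  ρ • (!![1, 0, 0, 0;
          0, b, c, 0;
          0, c', b', 0;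
          0, 0, 0, 1]).submatrix finProdFinEquiv finProdFinEquiv

/-- Normalization factor of the face elliptic `R`-matrix. -/
def ellipticRho (q z p : ℂ) : ℂ :=
  q ^ (-(1 / 2) : ℂ) *
    (qProd (q ^ 2 * z) ![p, q ^ 4] ^ 2 /
      (qProd z ![p, q ^ 4] * qProd (q ^ 4 * z) ![p, q ^ 4])) *
    (qProd (p * z⁻¹) ![p, q ^ 4] * qProd (p * q ^ 4 * z⁻¹) ![p, q ^ 4] /
      qProd (p * q ^ 2 * z⁻¹) ![p, q ^ 4] ^ 2)

/-- The face elliptic `R`-matrix `R(z; p, w)` of `B_{q,p,λ}(sl(2)^)`. -/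
def ellipticR (q z p w : ℂ) : Matrix (Fin 2 × Fin 2) (Fin 2 × Fin 2) ℂ :=
  faceMatrix (ellipticRho q z p)
    (q * (qProd (p * w⁻¹ * q ^ 2) ![p] * qProd (p * w⁻¹ * (q ^ 2)⁻¹) ![p] /
        qProd (p * w⁻¹) ![p] ^ 2) * (theta p z / theta p (q ^ 2 * z)))
    (theta p (q ^ 2) / theta p w * (theta p (w * z) / theta p (q ^ 2 * z)))
    (z * (theta p (q ^ 2) / theta p (p * w⁻¹)) *
      (theta p (p * w⁻¹ * z) / theta p (q ^ 2 * z)))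
    (q * (qProd (w * q ^ 2) ![p] * qProd (w * (q ^ 2)⁻¹) ![p] / qProd w ![p] ^ 2) *
      (theta p z / theta p (q ^ 2 * z)))

open Complex in
/-- Normalization factor `ρ(β; r)` of the `R`-matrix of `DY_{r,s}`. -/
def rho (β r : ℂ) : ℂ :=
  doubleSine (1 + I * β / Real.pi) r 2 ^ 2 /
    (doubleSine (I * β / Real.pi) r 2 * doubleSine (2 + I * β / Real.pi) r 2)

open Complex in
/-- Normalization factor of the vertex-type deformed double Yangian. -/
def rhoV8 (β r : ℂ) : ℂ :=
  -(doubleSine (-(I * β / Real.pi)) r 2 * doubleSine (1 + I * β / Real.pi) r 2 /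
      (doubleSine (I * β / Real.pi) r 2 * doubleSine (1 - I * β / Real.pi) r 2)) *
    Complex.cot (I * β / 2)

open Complex in
/-- The `R`-matrix `R(β; r, s)` of the dynamical deformed double Yangian `DY_{r,s}`. -/
def dynR (β r s : ℂ) : Matrix (Fin 2 × Fin 2) (Fin 2 × Fin 2) ℂ :=
  faceMatrix (rho β r)
    (gamma1 (r - s) r ^ 2 / (gamma1 (r - s + 1) r * gamma1 (r - s - 1) r) *
      (sin (I * β / r) / sin ((Real.pi + I * β) / r)))
    (sin ((Real.pi * s + I * β) / r) / sin (Real.pi * s / r) *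
      (sin (Real.pi / r) / sin ((Real.pi + I * β) / r)))
    (sin ((Real.pi * s - I * β) / r) / sin (Real.pi * s / r) *
      (sin (Real.pi / r) / sin ((Real.pi + I * β) / r)))
    (gamma1 s r ^ 2 / (gamma1 (s + 1) r * gamma1 (s - 1) r) *
      (sin (I * β / r) / sin ((Real.pi + I * β) / r)))

/-! ### Dynamical embeddings into `End (ℂ² ⊗ ℂ² ⊗ ℂ²)` -/

/-- Eigenvalues of `h = diag(1, -1)`. -/
def hEig : Fin 2 → ℂ := ![1, -1]

/-- `A₁₂`, where the matrix `A` may depend on the basis vector in the third factor. -/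
def emb12 (A : Fin 2 → Matrix (Fin 2 × Fin 2) (Fin 2 × Fin 2) ℂ) :
    Matrix (Fin 2 × Fin 2 × Fin 2) (Fin 2 × Fin 2 × Fin 2) ℂ :=
  Matrix.of fun i j =>
    if i.2.2 = j.2.2 then A i.2.2 (i.1, i.2.1) (j.1, j.2.1) else 0

/-- `A₁₃`, where the matrix `A` may depend on the basis vector in the second factor. -/
def emb13 (A : Fin 2 → Matrix (Fin 2 × Fin 2) (Fin 2 × Fin 2) ℂ) :
    Matrix (Fin 2 × Fin 2 × Fin 2) (Fin 2 × Fin 2 × Fin 2) ℂ :=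
  Matrix.of fun i j =>
    if i.2.1 = j.2.1 then A i.2.1 (i.1, i.2.2) (j.1, j.2.2) else 0

/-- `A₂₃`, where the matrix `A` may depend on the basis vector in the first factor. -/
def emb23 (A : Fin 2 → Matrix (Fin 2 × Fin 2) (Fin 2 × Fin 2) ℂ) :
    Matrix (Fin 2 × Fin 2 × Fin 2) (Fin 2 × Fin 2 × Fin 2) ℂ :=
  Matrix.of fun i j =>
    if i.1 = j.1 then A i.1 (i.2.1, i.2.2) (j.2.1, j.2.2) else 0

/-- The additive dynamical Yang–Baxter equation at `β, β'` and dynamical parameter `s`: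
`R₁₂(β, s + h⁽³⁾) R₁₃(β + β', s) R₂₃(β', s + h⁽¹⁾)
  = R₂₃(β', s) R₁₃(β + β', s + h⁽²⁾) R₁₂(β, s)`. -/
def DynYangBaxter (R : ℂ → ℂ → Matrix (Fin 2 × Fin 2) (Fin 2 × Fin 2) ℂ) (β β' s : ℂ) : Prop :=
  emb12 (fun k => R β (s + hEig k)) * emb13 (fun _ => R (β + β') s) *
      emb23 (fun k => R β' (s + hEig k)) =
    emb23 (fun _ => R β' s) * emb13 (fun k => R (β + β') (s + hEig k)) *
      emb12 (fun _ => R β s)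

end DynYangian

end

/-!
The three parts rest on one statement about products over a cone `{n₁ ω₁ + ⋯ + nₘ ωₘ}`, the range
of `latticePoint`. Call nodes `a j` with integer exponents `ε j` balanced if
`∑ j, ε j * a j ^ k = 0` for `0 ≤ k ≤ m`. All entries of both `R`-matrices are built from balanced
combinations (`m = 1` for the matrix entries, `m = 2` for the normalization factor), and for these
the product `∏ (a j + y) ^ ε j` over `j` and over the points `y` of the cone converges absolutely.

* `prod_multipleGamma_eq_tprod`: this product equals `∏ multipleGamma (a j) ω ^ (-ε j)`. The Barnes
  zeta function is continued through its Mellin representation, subtracting Taylor polynomials of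
  the generating function at `0` (`exists_isBarnesZeta`). In a balanced combination the terms of the
  Barnes series decay fast enough for the series to converge beyond `t = 0`, so its derivative at
  `0` can be taken term by term (`hasProd_multipleGamma`).
* `tendsto_prod_expProd`: the same product is the limit of the balanced `q`-products. The limit is
  taken factor by factor by dominated convergence. The uniform bound comes from vanishing moments
  and the Schwarz lemma (`norm_sum_mul_le_of_moments`), applied to `log (1 - e^{-yl})`, whose
  variation on a disc of radius `Re y / 2` around `y` is at most `1` whatever the scale `l > 0` is.

Comparing the two gives the scaling limit. For `m = 1` and the nodes `a, ω - a, b, ω - b` the product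
is Euler's product for a quotient of sines (`tprod_reflection`), which gives the limits of the theta
quotients and the reflection formula `gamma1_reflection`.

The normalization identity follows from the difference equation `multipleGamma_eq_mul_shift` and the
reflection formula for the period `2`. In the dynamical Yang–Baxter equation the gamma factors of
the two diagonal entries enter only through their product, which the reflection formula makes
trigonometric; what remains is a list of rational identities in exponentials
(`trigFace_yangBaxter`).
-/

noncomputable section

namespace DynYangian

/-! ### Sums over the lattice cone -/

/-- The lattice point `n₁ ω₁ + ⋯ + nₘ ωₘ`, definitionally the sum in `IsBarnesZeta` and
`multipleGamma`. -/
def latticePoint {m : ℕ} (ω : Fin m → ℂ) (n : Fin m → ℕ) : ℂ := ∑ i, (n i : ℂ) * ω i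

/-- The height `1 + n₁ + ⋯ + nₘ`, which measures the size of `latticePoint ω n`. -/
def height {m : ℕ} (n : Fin m → ℕ) : ℝ := 1 + ∑ i, (n i : ℝ)

theorem one_le_height {m : ℕ} (n : Fin m → ℕ) : 1 ≤ height n := by
  unfold height
  have : 0 ≤ ∑ i, (n i : ℝ) := Finset.sum_nonneg fun i _ => Nat.cast_nonneg _
  linarith

theorem height_pos {m : ℕ} (n : Fin m → ℕ) : 0 < height n :=
  zero_lt_one.trans_le (one_le_height n)

/-- A product of absolutely convergent series in independent indices is the sum over all tuples of
indices. -/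
theorem hasSum_pi_prod {m : ℕ} {f : Fin m → ℕ → ℂ} {s : Fin m → ℂ}
    (hf : ∀ i, HasSum (f i) (s i)) (hn : ∀ i, Summable fun k => ‖f i k‖) :
    (HasSum (fun n : Fin m → ℕ => ∏ i, f i (n i)) (∏ i, s i)) ∧
      Summable fun n : Fin m → ℕ => ‖∏ i, f i (n i)‖ := by
  induction m with
  | zero =>
    constructor
    · simp
    · exact (hasSum_unique _).summable
  | succ m ih =>
    obtain ⟨h1, h2⟩ := ih (fun i => hf i.succ) (fun i => hn i.succ)
    have hs := summable_mul_of_summable_norm (hn 0) h2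
    have hs' := Summable.mul_norm (hn 0) h2
    have hp := (hf 0).mul h1 hs
    rw [← (Fin.consEquiv fun _ : Fin (m + 1) => ℕ).hasSum_iff,
      ← (Fin.consEquiv fun _ : Fin (m + 1) => ℕ).summable_iff]
    constructor
    · convert! hp using 1
      · ext p
        simp [Fin.consEquiv, Fin.prod_univ_succ]
      · rw [Fin.prod_univ_succ]
    · convert! hs' using 1
      ext p
      simp [Fin.consEquiv, Fin.prod_univ_succ]

theorem summable_height_rpow {m : ℕ} {σ : ℝ} (hσ : (m : ℝ) < σ) :
    Summable fun n : Fin m → ℕ => height n ^ (-σ) := by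
  rcases Nat.eq_zero_or_pos m with rfl | hm
  · exact (hasSum_unique _).summable
  have hm' : (0 : ℝ) < m := by exact_mod_cast hm
  have hk : Summable fun k : ℕ => ((k : ℝ) + 1) ^ (-(σ / m)) := by
    have h1 : -(σ / m) < -1 := by
      rw [neg_lt_neg_iff, lt_div_iff₀ hm']; linarith
    have := (summable_nat_add_iff 1).2 (Real.summable_nat_rpow.2 h1)
    simpa using this
  have hk' : Summable fun k : ℕ => ‖((((k : ℝ) + 1) ^ (-(σ / m)) : ℝ) : ℂ)‖ := by
    refine hk.congr fun k => ?_
    rw [Complex.norm_real, Real.norm_of_nonneg (by positivity)]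
  have := (hasSum_pi_prod (m := m)
    (f := fun _ k => ((((k : ℝ) + 1) ^ (-(σ / m)) : ℝ) : ℂ))
    (fun i => hk'.of_norm.hasSum) (fun i => hk')).2
  refine this.of_nonneg_of_le (fun n => Real.rpow_nonneg (height_pos n).le _) fun n => ?_
  rw [norm_prod]
  have h2 : ∀ i, ‖((((n i : ℝ) + 1) ^ (-(σ / m)) : ℝ) : ℂ)‖ = ((n i : ℝ) + 1) ^ (-(σ / m)) := by
    intro i
    rw [Complex.norm_real, Real.norm_of_nonneg (by positivity)]
  simp_rw [h2]
  -- each factor `n i + 1` is at most the height, and there are `m` of them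
  have h3 : ∀ i, height n ^ (-(σ / m)) ≤ ((n i : ℝ) + 1) ^ (-(σ / m)) := by
    intro i
    refine Real.rpow_le_rpow_of_nonpos (by positivity) ?_ ?_
    · unfold height
      have := Finset.single_le_sum (f := fun i => (n i : ℝ)) (fun j _ => Nat.cast_nonneg (n j))
        (Finset.mem_univ i)
      linarith
    · have : 0 ≤ σ / m := div_nonneg (by linarith) hm'.le
      linarith
  calc height n ^ (-σ) = ∏ _i : Fin m, height n ^ (-(σ / m)) := by
        rw [Finset.prod_const, Finset.card_univ, Fintype.card_fin, ← Real.rpow_natCast,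
          ← Real.rpow_mul (height_pos n).le]
        congr 1
        field_simp
    _ ≤ _ := Finset.prod_le_prod (fun i _ => Real.rpow_nonneg (height_pos n).le _) fun i _ => h3 i

theorem tendsto_height_cofinite {m : ℕ} :
    Tendsto (height : (Fin m → ℕ) → ℝ) cofinite atTop := by
  have h := (summable_height_rpow (m := m) (σ := m + 1) (by linarith)).tendsto_cofinite_zero
  refine tendsto_atTop.2 fun K => ?_
  have hK : (0 : ℝ) < (max K 1) ^ (-((m : ℝ) + 1)) := by positivity
  filter_upwards [h.eventually_lt_const hK] with n hn
  by_contra! hlt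
  have := Real.rpow_le_rpow_of_nonpos (z := -((m : ℝ) + 1)) (height_pos n)
    (hlt.le.trans (le_max_left K 1)) (by have : (0 : ℝ) ≤ m := Nat.cast_nonneg m; linarith)
  linarith

theorem exists_height_le_re {m : ℕ} {ω : Fin m → ℂ} (hω : ∀ i, 0 < (ω i).re) :
    ∃ c > 0, ∀ n, c * (height n - 1) ≤ (latticePoint ω n).re := by
  rcases isEmpty_or_nonempty (Fin m) with h | h
  · refine ⟨1, one_pos, fun n => ?_⟩
    simp [height, latticePoint]
  · obtain ⟨i₀, h₀⟩ := Finite.exists_min fun i => (ω i).re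
    refine ⟨(ω i₀).re, hω i₀, fun n => ?_⟩
    simp only [height, latticePoint, add_sub_cancel_left, Complex.re_sum, Finset.mul_sum]
    refine Finset.sum_le_sum fun i _ => ?_
    rw [← Complex.ofReal_natCast, Complex.re_ofReal_mul, mul_comm]
    exact mul_le_mul_of_nonneg_left (h₀ i) (Nat.cast_nonneg _)

theorem exists_norm_le_height {m : ℕ} (ω : Fin m → ℂ) (a : ℂ) :
    ∃ C > 0, ∀ n, ‖a + latticePoint ω n‖ ≤ C * height n := by
  refine ⟨1 + ‖a‖ + ∑ i, ‖ω i‖, by positivity, fun n => ?_⟩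
  have h1 : ‖latticePoint ω n‖ ≤ (∑ i, ‖ω i‖) * height n := by
    unfold latticePoint
    refine (norm_sum_le _ _).trans ?_
    rw [Finset.sum_mul]
    refine Finset.sum_le_sum fun i _ => ?_
    rw [norm_mul, Complex.norm_natCast, mul_comm]
    refine mul_le_mul_of_nonneg_left ?_ (norm_nonneg _)
    unfold height
    have := Finset.single_le_sum (f := fun i => (n i : ℝ)) (fun j _ => Nat.cast_nonneg (n j))
      (Finset.mem_univ i)
    linarith
  have h2 := one_le_height n
  have h3 : ‖a‖ ≤ ‖a‖ * height n := le_mul_of_one_le_right (norm_nonneg a) h2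
  calc ‖a + latticePoint ω n‖ ≤ ‖a‖ + ‖latticePoint ω n‖ := norm_add_le _ _
    _ ≤ ‖a‖ * height n + (∑ i, ‖ω i‖) * height n := add_le_add h3 h1
    _ ≤ _ := by nlinarith

/-- All but finitely many points of a shifted cone lie to the right of a multiple of their
height. -/
theorem exists_eventually_height_le_re {m : ℕ} {ω : Fin m → ℂ} (hω : ∀ i, 0 < (ω i).re) :
    ∃ c > 0, ∀ K : ℝ, ∀ᶠ n in cofinite, c * height n + K ≤ (latticePoint ω n).re := by
  obtain ⟨c, hc, h⟩ := exists_height_le_re hω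
  refine ⟨c / 2, by positivity, fun K => ?_⟩
  filter_upwards [tendsto_height_cofinite.eventually_ge_atTop (2 * (K + c) / c)] with n hn
  have h1 := h n
  rw [div_le_iff₀ hc] at hn
  linarith

/-! ### Vanishing moments -/

/-- If the weights `ε` at the nodes `a` have vanishing moments of orders below `k`, then the
weighted sum of the values of a bounded holomorphic function is of order `k` in the ratio of the
nodes to the radius. Dividing `f - f 0` by the variable turns `k + 1` vanishing moments of `ε`
into `k` vanishing moments of `ε * a`; the Schwarz lemma controls the quotient. -/
theorem norm_sum_mul_le_of_moments {J : Type*} [Fintype J] {k : ℕ} {ε a : J → ℂ}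
    (hε : ∀ i < k, ∑ j, ε j * a j ^ i = 0) {f : ℂ → ℂ} {R M : ℝ} (hR : 0 < R)
    (hf : DifferentiableOn ℂ f (Metric.ball 0 R)) (hM : ∀ w ∈ Metric.ball (0 : ℂ) R, ‖f w‖ ≤ M)
    (ha : ∀ j, a j ∈ Metric.ball (0 : ℂ) R) :
    ‖∑ j, ε j * f (a j)‖ ≤ (2 / R) ^ k * M * ∑ j, ‖ε j‖ * ‖a j‖ ^ k := by
  induction k generalizing ε f M with
  | zero =>
    simp only [pow_zero, one_mul, mul_one]
    refine (norm_sum_le _ _).trans ?_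
    rw [Finset.mul_sum]
    refine Finset.sum_le_sum fun j _ => ?_
    rw [norm_mul, mul_comm]
    exact mul_le_mul_of_nonneg_right (hM _ (ha j)) (norm_nonneg _)
  | succ k ih =>
    have h0 : (0 : ℂ) ∈ Metric.ball (0 : ℂ) R := Metric.mem_ball_self hR
    have hg : DifferentiableOn ℂ (dslope f 0) (Metric.ball 0 R) :=
      (Complex.differentiableOn_dslope (Metric.isOpen_ball.mem_nhds h0)).2 hf
    have hgM : ∀ w ∈ Metric.ball (0 : ℂ) R, ‖dslope f 0 w‖ ≤ 2 * M / R := by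
      intro w hw
      refine Complex.norm_dslope_le_div_of_mapsTo_ball hf (fun z hz => ?_) hw
      rw [mem_closedBall_iff_norm]
      calc ‖f z - f 0‖ ≤ ‖f z‖ + ‖f 0‖ := norm_sub_le _ _
        _ ≤ 2 * M := by linarith [hM z hz, hM 0 h0]
    have key := ih (ε := fun j => ε j * a j) (f := dslope f 0) (M := 2 * M / R)
      (fun i hi => by
        rw [← hε (i + 1) (by omega)]
        exact Finset.sum_congr rfl fun j _ => by ring) hg hgM
    have e : ∑ j, ε j * f (a j) = ∑ j, ε j * a j * dslope f 0 (a j) := by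
      have : ∀ j, ε j * f (a j) = ε j * a j ^ 0 * f 0 + ε j * a j * dslope f 0 (a j) := by
        intro j
        have := sub_smul_dslope f 0 (a j)
        simp only [sub_zero, smul_eq_mul] at this
        linear_combination (-ε j) * this
      simp_rw [this]
      rw [Finset.sum_add_distrib, ← Finset.sum_mul, hε 0 (by omega), zero_mul, zero_add]
    rw [e]
    refine key.trans (le_of_eq ?_)
    have : ∀ j, ‖ε j * a j‖ * ‖a j‖ ^ k = ‖ε j‖ * ‖a j‖ ^ (k + 1) := fun j => by
      rw [norm_mul]; ring
    simp_rw [this]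
    rw [pow_succ]
    ring

/-! ### Punctured half-planes -/

theorem isPreconnected_halfPlane_diff (A : ℝ) {S : Set ℂ} (hS : S.Countable) :
    IsPreconnected ({t : ℂ | A < t.re} \ S) := by
  -- the half-plane is homeomorphic to the plane, where countable sets do not disconnect
  let F : ℂ → ℂ := fun z => ⟨Real.exp z.re + A, z.im⟩
  have hF : Continuous F := by
    have : F = fun z => ((Real.exp z.re + A : ℝ) : ℂ) + (z.im : ℂ) * Complex.I := by
      ext z
      exact Complex.mk_eq_add_mul_I _ _
    rw [this]
    fun_prop
  have hinj : Function.Injective F := by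
    intro z w h
    have h1 := congrArg Complex.re h
    have h2 := congrArg Complex.im h
    simp only [F, add_left_inj, Real.exp_eq_exp] at h1 h2
    exact Complex.ext h1 h2
  have himg : {t : ℂ | A < t.re} \ S = F '' (F ⁻¹' S)ᶜ := by
    ext t
    constructor
    · rintro ⟨h1, h2⟩
      have h1' : A < t.re := h1
      have : F ⟨Real.log (t.re - A), t.im⟩ = t := by
        simp only [F]
        rw [Real.exp_log (by linarith), sub_add_cancel]
      exact ⟨_, by simpa [this] using h2, this⟩
    · rintro ⟨z, hz, rfl⟩
      refine ⟨?_, hz⟩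
      change A < Real.exp z.re + A
      linarith [Real.exp_pos z.re]
  rw [himg]
  refine IsPreconnected.image ?_ _ hF.continuousOn
  refine (Set.Countable.isConnected_compl_of_one_lt_rank ?_ (hS.preimage hinj)).isPreconnected
  rw [Complex.rank_real_complex]
  exact_mod_cast Nat.one_lt_two

/-! ### The Mellin transform of an exponential with complex rate -/

open MeasureTheory in
theorem mellinConvergent_cexp_neg_mul {t z : ℂ} (ht : 0 < t.re) (hz : 0 < z.re) :
    MellinConvergent (fun u : ℝ => Complex.exp (-(z * u))) t := by
  refine mellinConvergent_of_isBigO_rpow_exp (a := z.re) (b := 0) hz ?_ ?_ ?_ ht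
  · exact (Continuous.continuousOn (by fun_prop)).locallyIntegrableOn measurableSet_Ioi
  · refine Asymptotics.IsBigO.of_bound 1 (Eventually.of_forall fun u => ?_)
    simp [Complex.norm_exp]
  · simp only [neg_zero, Real.rpow_zero]
    refine Tendsto.isBigO_one ℝ (c := (1 : ℂ)) ?_
    have : Continuous fun u : ℝ => Complex.exp (-(z * u)) := by fun_prop
    simpa using (this.tendsto 0).mono_left nhdsWithin_le_nhds

open MeasureTheory in
theorem integral_norm_cpow_mul_cexp {t z : ℂ} (ht : 0 < t.re) (hz : 0 < z.re) :
    ∫ u : ℝ in Set.Ioi 0, ‖(u : ℂ) ^ (t - 1) • Complex.exp (-(z * u))‖ =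
      z.re ^ (-t.re) * Real.Gamma t.re := by
  have h := Real.integral_rpow_mul_exp_neg_mul_Ioi ht hz
  rw [one_div, Real.inv_rpow hz.le, ← Real.rpow_neg hz.le] at h
  rw [← h]
  refine setIntegral_congr_fun measurableSet_Ioi fun u hu => ?_
  simp only [norm_smul, Complex.norm_exp]
  rw [Complex.norm_cpow_eq_rpow_re_of_pos hu]
  simp

open MeasureTheory in
/-- Both sides are holomorphic in the rate `z`, and for positive `z` this is Euler's integral. -/
theorem mellin_cexp_neg_mul {t z : ℂ} (ht : 0 < t.re) (hz : 0 < z.re) :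
    mellin (fun u : ℝ => Complex.exp (-(z * u))) t = z ^ (-t) * Complex.Gamma t := by
  have hU : IsOpen {z : ℂ | 0 < z.re} := isOpen_lt continuous_const Complex.continuous_re
  have hconv : IsPreconnected {z : ℂ | 0 < z.re} := (convex_halfSpace_re_gt 0).isPreconnected
  have hL : DifferentiableOn ℂ
      (fun z : ℂ => mellin (fun u : ℝ => Complex.exp (-(z * u))) t) {z : ℂ | 0 < z.re} := by
    intro z₀ hz₀
    have hz₀' : 0 < z₀.re := hz₀
    refine DifferentiableAt.differentiableWithinAt ?_
    have hball : Metric.ball z₀ (z₀.re / 2) ∈ 𝓝 z₀ := Metric.ball_mem_nhds _ (by positivity)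
    have hre : ∀ z ∈ Metric.ball z₀ (z₀.re / 2), z₀.re / 2 ≤ z.re := by
      intro z hz
      have h1 := (Complex.abs_re_le_norm (z - z₀)).trans (mem_ball_iff_norm.1 hz).le
      rw [Complex.sub_re, abs_le] at h1
      linarith [h1.1]
    have hmeas : ∀ z : ℂ, AEStronglyMeasurable
        (fun u : ℝ => (u : ℂ) ^ (t - 1) • Complex.exp (-(z * u)))
        (volume.restrict (Set.Ioi 0)) := by
      intro z
      refine ContinuousOn.aestronglyMeasurable ?_ measurableSet_Ioi
      have hc : Continuous fun u : ℝ => Complex.exp (-(z * u)) := by fun_prop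
      have hp : ContinuousOn (fun u : ℝ => (u : ℂ) ^ (t - 1)) (Set.Ioi 0) := fun u hu =>
        (Complex.continuousAt_ofReal_cpow_const u _ (Or.inr (ne_of_gt hu))).continuousWithinAt
      exact hp.smul hc.continuousOn
    have hder := hasDerivAt_integral_of_dominated_loc_of_deriv_le
      (μ := volume.restrict (Set.Ioi (0 : ℝ))) (𝕜 := ℂ)
      (F := fun z (u : ℝ) => (u : ℂ) ^ (t - 1) • Complex.exp (-(z * u)))
      (F' := fun z (u : ℝ) => (u : ℂ) ^ (t - 1) • (-(u : ℂ) * Complex.exp (-(z * u))))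
      (bound := fun u : ℝ => u ^ (t.re + 1 - 1) * Real.exp (-(z₀.re / 2 * u)))
      hball (Eventually.of_forall hmeas)
      (mellinConvergent_cexp_neg_mul ht hz₀') ?_ ?_ ?_ ?_
    · exact hder.2.differentiableAt
    · have : (fun u : ℝ => (u : ℂ) ^ (t - 1) • (-(u : ℂ) * Complex.exp (-(z₀ * u)))) =
          fun u : ℝ => (-(u : ℂ)) • ((u : ℂ) ^ (t - 1) • Complex.exp (-(z₀ * u))) := by
        ext u
        simp only [smul_eq_mul]
        ring
      rw [this]
      have hc : Continuous fun u : ℝ => -(u : ℂ) := by fun_prop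
      exact hc.aestronglyMeasurable.smul (hmeas z₀)
    · refine (ae_restrict_iff' measurableSet_Ioi).2 (Eventually.of_forall fun u hu z hz => ?_)
      have hu' : (0 : ℝ) < u := hu
      rw [norm_smul, norm_mul, norm_neg, Complex.norm_real, Real.norm_of_nonneg hu'.le,
        Complex.norm_cpow_eq_rpow_re_of_pos hu', Complex.norm_exp, ← mul_assoc,
        ← Real.rpow_add_one hu'.ne']
      have h1 : (t - 1).re + 1 = t.re + 1 - 1 := by simp
      rw [h1]
      refine mul_le_mul_of_nonneg_left (Real.exp_le_exp.2 ?_) (Real.rpow_nonneg hu'.le _)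
      simp only [Complex.neg_re, Complex.mul_re, Complex.ofReal_re, Complex.ofReal_im, mul_zero,
        sub_zero]
      exact neg_le_neg (mul_le_mul_of_nonneg_right (hre z hz) hu'.le)
    · have := mellinConvergent_cexp_neg_mul (t := ((t.re + 1 : ℝ) : ℂ)) (z := ((z₀.re / 2 : ℝ) : ℂ))
        (by rw [Complex.ofReal_re]; linarith) (by rw [Complex.ofReal_re]; positivity)
      refine (this.norm).congr ?_
      refine (ae_restrict_iff' measurableSet_Ioi).2 (Eventually.of_forall fun u hu => ?_)
      have hu' : (0 : ℝ) < u := hu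
      simp only [norm_smul, Complex.norm_exp]
      rw [Complex.norm_cpow_eq_rpow_re_of_pos hu']
      simp
    · refine Eventually.of_forall fun u z _ => ?_
      have : HasDerivAt (fun z : ℂ => Complex.exp (-(z * u)))
          (-(u : ℂ) * Complex.exp (-(z * u))) z := by
        have h1 : HasDerivAt (fun z : ℂ => -(z * (u : ℂ))) (-(u : ℂ)) z := by
          simpa using ((hasDerivAt_id z).mul_const (u : ℂ)).fun_neg
        simpa [mul_comm] using h1.cexp
      exact this.const_smul ((u : ℂ) ^ (t - 1))
  have hR : DifferentiableOn ℂ (fun z : ℂ => z ^ (-t) * Complex.Gamma t) {z : ℂ | 0 < z.re} := by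
    intro z hz
    refine DifferentiableAt.differentiableWithinAt ?_
    exact (differentiableAt_id.cpow_const (Or.inl hz)).mul_const _
  have h1 : (1 : ℂ) ∈ {z : ℂ | 0 < z.re} := by simp
  refine (hL.analyticOnNhd hU).eqOn_of_preconnected_of_frequently_eq (hR.analyticOnNhd hU) hconv
    h1 ?_ hz
  -- the two sides agree at the points `1 + 1 / (k + 1)`
  have hseq : Tendsto (fun k : ℕ => ((1 + 1 / ((k : ℝ) + 1) : ℝ) : ℂ)) atTop (𝓝[≠] 1) := by
    refine tendsto_nhdsWithin_iff.2 ⟨?_, Eventually.of_forall fun k => ?_⟩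
    · have : Tendsto (fun k : ℕ => (1 + 1 / ((k : ℝ) + 1) : ℝ)) atTop (𝓝 (1 + 0)) :=
        tendsto_one_div_add_atTop_nhds_zero_nat.const_add 1
      have h2 := (Complex.continuous_ofReal.tendsto _).comp this
      simpa [Function.comp_def] using h2
    · have h3 : (0 : ℝ) < 1 / ((k : ℝ) + 1) := by positivity
      intro h
      have h4 : (1 + 1 / ((k : ℝ) + 1) : ℝ) = 1 := Complex.ofReal_eq_one.1 h
      linarith
  refine hseq.frequently (Frequently.of_forall fun k => ?_)
  have hp : (0 : ℝ) < 1 + 1 / ((k : ℝ) + 1) := by positivity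
  generalize (1 + 1 / ((k : ℝ) + 1) : ℝ) = p at hp
  have := Complex.integral_cpow_mul_exp_neg_mul_Ioi ht hp
  simp only [mellin, smul_eq_mul]
  rw [this, one_div, Complex.inv_cpow, Complex.cpow_neg]
  rw [Complex.arg_ofReal_of_nonneg hp.le]
  exact Real.pi_pos.ne

/-! ### The Mellin representation of the Barnes zeta series -/

/-- The generating function `e^{-xu} / ∏ᵢ (1 - e^{-ωᵢ u})` of the exponentials of the points of the
shifted cone. -/
def barnesKernel {m : ℕ} (x : ℂ) (ω : Fin m → ℂ) (u : ℝ) : ℂ :=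
  Complex.exp (-(x * u)) * ∏ i, (1 - Complex.exp (-(ω i * u)))⁻¹

theorem norm_cexp_neg_mul_lt_one {w : ℂ} (hw : 0 < w.re) {u : ℝ} (hu : 0 < u) :
    ‖Complex.exp (-(w * u))‖ < 1 := by
  rw [Complex.norm_exp, Real.exp_lt_one_iff]
  simp only [Complex.neg_re, Complex.mul_re, Complex.ofReal_re, Complex.ofReal_im, mul_zero,
    sub_zero]
  exact neg_lt_zero.2 (mul_pos hw hu)

theorem one_sub_cexp_neg_mul_ne_zero {w : ℂ} (hw : 0 < w.re) {u : ℝ} (hu : 0 < u) :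
    1 - Complex.exp (-(w * u)) ≠ 0 := by
  intro h
  have h1 := norm_cexp_neg_mul_lt_one hw hu
  rw [← sub_eq_zero.1 h, norm_one] at h1
  exact lt_irrefl _ h1

theorem cexp_latticePoint {m : ℕ} (ω : Fin m → ℂ) (n : Fin m → ℕ) (v : ℂ) :
    Complex.exp (-(latticePoint ω n * v)) = ∏ i, Complex.exp (-(ω i * v)) ^ n i := by
  simp_rw [← Complex.exp_nat_mul]
  rw [← Complex.exp_sum]
  congr 1
  rw [latticePoint, Finset.sum_mul, ← Finset.sum_neg_distrib]
  exact Finset.sum_congr rfl fun i _ => by ring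

theorem hasSum_barnesKernel {m : ℕ} (x : ℂ) {ω : Fin m → ℂ} (hω : ∀ i, 0 < (ω i).re) {u : ℝ}
    (hu : 0 < u) :
    HasSum (fun n => Complex.exp (-((x + latticePoint ω n) * u))) (barnesKernel x ω u) := by
  have h := (hasSum_pi_prod (f := fun i k => Complex.exp (-(ω i * u)) ^ k)
    (s := fun i => (1 - Complex.exp (-(ω i * u)))⁻¹)
    (fun i => hasSum_geometric_of_norm_lt_one (norm_cexp_neg_mul_lt_one (hω i) hu))
    (fun i => by
      simp_rw [norm_pow]
      exact summable_geometric_of_lt_one (norm_nonneg _)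
        (norm_cexp_neg_mul_lt_one (hω i) hu))).1
  refine (h.mul_left (Complex.exp (-(x * u)))).congr_fun fun n => ?_
  rw [← cexp_latticePoint, ← Complex.exp_add]
  congr 1
  ring

theorem summable_norm_cpow_latticePoint {m : ℕ} (x : ℂ) {ω : Fin m → ℂ} (hω : ∀ i, 0 < (ω i).re)
    {t : ℂ} (ht : (m : ℝ) < t.re) :
    Summable fun n => ‖(x + latticePoint ω n) ^ (-t)‖ := by
  obtain ⟨c, hc, h⟩ := exists_eventually_height_le_re hω
  have hm : (0 : ℝ) ≤ m := Nat.cast_nonneg m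
  refine ((summable_height_rpow ht).mul_left
    (c ^ (-t.re) * Real.exp (Real.pi * |t.im|))).of_norm_bounded_eventually ?_
  filter_upwards [h (-x.re)] with n hn
  have h1 : c * height n ≤ (x + latticePoint ω n).re := by
    rw [Complex.add_re]; linarith
  have h2 : 0 < c * height n := mul_pos hc (height_pos n)
  rw [norm_norm]
  have h3 : x + latticePoint ω n ≠ 0 := by
    intro h0
    rw [h0, Complex.zero_re] at h1
    linarith
  rw [Complex.norm_cpow_of_ne_zero h3, Complex.neg_re, Complex.neg_im, div_eq_mul_inv,
    ← Real.exp_neg]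
  have h4 : ‖x + latticePoint ω n‖ ^ (-t.re) ≤ c ^ (-t.re) * height n ^ (-t.re) := by
    rw [← Real.mul_rpow hc.le (height_pos n).le]
    exact Real.rpow_le_rpow_of_nonpos h2 (h1.trans (Complex.re_le_norm _)) (by linarith)
  have h5 : Real.exp (-(Complex.arg (x + latticePoint ω n) * -t.im)) ≤
      Real.exp (Real.pi * |t.im|) := by
    rw [Real.exp_le_exp]
    calc -(Complex.arg (x + latticePoint ω n) * -t.im)
        = Complex.arg (x + latticePoint ω n) * t.im := by ring
      _ ≤ |Complex.arg (x + latticePoint ω n) * t.im| := le_abs_self _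
      _ ≤ _ := by
        rw [abs_mul]
        exact mul_le_mul_of_nonneg_right (Complex.abs_arg_le_pi _) (abs_nonneg _)
  calc _ ≤ c ^ (-t.re) * height n ^ (-t.re) * Real.exp (Real.pi * |t.im|) := by
        have := height_pos n
        gcongr
    _ = _ := by ring

open MeasureTheory in
/-- For `Re x > 0` and `Re t > m` the Barnes series is the Mellin transform of the kernel, divided by
`Γ(t)`. -/
theorem hasSum_mellin_barnesKernel {m : ℕ} {x : ℂ} (hx : 0 < x.re) {ω : Fin m → ℂ}
    (hω : ∀ i, 0 < (ω i).re) {t : ℂ} (ht : (m : ℝ) < t.re) :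
    HasSum (fun n => (x + latticePoint ω n) ^ (-t) * Complex.Gamma t)
      (mellin (barnesKernel x ω) t) := by
  have ht0 : 0 < t.re := (Nat.cast_nonneg m).trans_lt ht
  obtain ⟨c, hc, hle⟩ := exists_height_le_re hω
  have hre : ∀ n, 0 < (x + latticePoint ω n).re := fun n => by
    have h1 := hle n
    have h2 : 0 ≤ c * (height n - 1) := mul_nonneg hc.le (by linarith [one_le_height n])
    rw [Complex.add_re]; linarith
  have hsum := hasSum_integral_of_summable_integral_norm
    (μ := volume.restrict (Set.Ioi (0 : ℝ)))
    (F := fun n (u : ℝ) => (u : ℂ) ^ (t - 1) • Complex.exp (-((x + latticePoint ω n) * u)))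
    (fun n => mellinConvergent_cexp_neg_mul ht0 (hre n)) ?_
  · have e1 : ∀ n, ∫ u : ℝ in Set.Ioi 0,
        (u : ℂ) ^ (t - 1) • Complex.exp (-((x + latticePoint ω n) * u)) =
          (x + latticePoint ω n) ^ (-t) * Complex.Gamma t :=
      fun n => mellin_cexp_neg_mul ht0 (hre n)
    simp_rw [e1] at hsum
    convert! hsum using 1
    rw [mellin]
    refine setIntegral_congr_fun measurableSet_Ioi fun u hu => ?_
    exact ((hasSum_barnesKernel x hω hu).const_smul ((u : ℂ) ^ (t - 1))).tsum_eq.symm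
  · have e2 : ∀ n, ∫ u : ℝ in Set.Ioi 0,
        ‖(u : ℂ) ^ (t - 1) • Complex.exp (-((x + latticePoint ω n) * u))‖ =
          (x + latticePoint ω n).re ^ (-t.re) * Real.Gamma t.re :=
      fun n => integral_norm_cpow_mul_cexp ht0 (hre n)
    simp_rw [e2]
    refine Summable.mul_right _ ?_
    set d := min x.re c
    have hd : 0 < d := lt_min hx hc
    refine ((summable_height_rpow ht).mul_left (d ^ (-t.re))).of_nonneg_of_le
      (fun n => Real.rpow_nonneg (hre n).le _) fun n => ?_
    rw [← Real.mul_rpow hd.le (height_pos n).le]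
    refine Real.rpow_le_rpow_of_nonpos (mul_pos hd (height_pos n)) ?_ (by linarith)
    have h1 := hle n
    have h2 : d * 1 ≤ x.re := by rw [mul_one]; exact min_le_left _ _
    have h3 : d * (height n - 1) ≤ c * (height n - 1) :=
      mul_le_mul_of_nonneg_right (min_le_right _ _) (by linarith [one_le_height n])
    rw [Complex.add_re]
    linarith

/-! ### Analytic continuation of the Barnes zeta series -/

/-- Multiplied by `u ^ m`, which cancels its pole at `0`, the kernel extends analytically. The extra
factor `e ^ u` is the inverse of the one in `kernelRemainder`. -/
theorem exists_analyticAt_barnesKernel {m : ℕ} (x : ℂ) {ω : Fin m → ℂ}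
    (hω : ∀ i, 0 < (ω i).re) :
    ∃ φ : ℂ → ℂ, AnalyticAt ℂ φ 0 ∧
      ∀ u : ℝ, 0 < u → barnesKernel x ω u * (u : ℂ) ^ m * Complex.exp u = φ u := by
  have hd : ∀ i, Differentiable ℂ fun v : ℂ => 1 - Complex.exp (-(ω i * v)) := fun i => by fun_prop
  have hdiff : ∀ i, Differentiable ℂ (dslope (fun v : ℂ => 1 - Complex.exp (-(ω i * v))) 0) := by
    intro i
    rw [← differentiableOn_univ, Complex.differentiableOn_dslope univ_mem]
    exact (hd i).differentiableOn
  refine ⟨fun v => Complex.exp ((1 - x) * v) *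
    ∏ i, (dslope (fun v : ℂ => 1 - Complex.exp (-(ω i * v))) 0 v)⁻¹, ?_, ?_⟩
  · refine AnalyticAt.mul ?_ ?_
    · exact Differentiable.analyticAt (by fun_prop) 0
    · refine Finset.analyticAt_fun_prod _ fun i _ => ((hdiff i).analyticAt 0).inv ?_
      have h1 : HasDerivAt (fun v : ℂ => 1 - Complex.exp (-(ω i * v))) (ω i) 0 := by
        have h2 : HasDerivAt (fun v : ℂ => -(ω i * v)) (-(ω i)) 0 := by
          simpa using ((hasDerivAt_id (0 : ℂ)).const_mul (ω i)).fun_neg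
        simpa using (h2.cexp).const_sub 1
      rw [dslope_same, h1.deriv]
      intro h0
      have := hω i
      rw [h0] at this
      simp at this
  · intro u hu
    have hu' : (u : ℂ) ≠ 0 := Complex.ofReal_ne_zero.2 hu.ne'
    have h1 : ∀ i, (dslope (fun v : ℂ => 1 - Complex.exp (-(ω i * v))) 0 u)⁻¹ =
        (1 - Complex.exp (-(ω i * u)))⁻¹ * u := by
      intro i
      rw [dslope_of_ne _ hu', slope_def_field]
      simp [div_eq_mul_inv, mul_comm]
    simp_rw [h1]
    rw [Finset.prod_mul_distrib, Finset.prod_const, Finset.card_univ, Fintype.card_fin,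
      barnesKernel]
    have h2 : Complex.exp ((1 - x) * u) = Complex.exp (-(x * u)) * Complex.exp u := by
      rw [← Complex.exp_add]
      congr 1
      ring
    rw [h2]
    ring

/-- The part of the kernel removed by its Taylor polynomial of order `K`; the factor `e^{-u}` makes
the Mellin transforms of the removed terms into gamma functions. -/
def kernelRemainder {m : ℕ} (x : ℂ) (ω : Fin m → ℂ) (d : ℕ → ℂ) (K : ℕ) (u : ℝ) : ℂ :=
  barnesKernel x ω u -
    ∑ k ∈ Finset.range K, d k * ((u : ℂ) ^ ((k : ℂ) - m) * Complex.exp (-u))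

/-- With the Taylor coefficients of the regularized kernel, the remainder of order `K` is
`O(u ^ (K - m))` at `0`. -/
theorem exists_kernelRemainder_isBigO {m : ℕ} (x : ℂ) {ω : Fin m → ℂ}
    (hω : ∀ i, 0 < (ω i).re) :
    ∃ d : ℕ → ℂ, ∀ K : ℕ, kernelRemainder x ω d K =O[𝓝[>] 0]
      fun u : ℝ => u ^ ((K : ℝ) - m) := by
  obtain ⟨φ, ⟨p, hp⟩, hφ⟩ := exists_analyticAt_barnesKernel x hω
  refine ⟨p.coeff, fun K => ?_⟩
  have h1 := hp.isBigO_sub_partialSum_pow K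
  have h2 : Tendsto (fun u : ℝ => (u : ℂ)) (𝓝[>] 0) (𝓝 0) := by
    have := Complex.continuous_ofReal.tendsto 0
    rw [Complex.ofReal_zero] at this
    exact this.mono_left nhdsWithin_le_nhds
  have h3 := h1.comp_tendsto h2
  have h4 : (fun u : ℝ => Complex.exp (-u) * (u : ℂ) ^ (-(m : ℂ))) =O[𝓝[>] 0]
      fun u : ℝ => u ^ (-(m : ℝ)) := by
    refine Asymptotics.IsBigO.of_bound 1 ?_
    filter_upwards [self_mem_nhdsWithin] with u hu
    have hu' : (0 : ℝ) < u := hu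
    rw [norm_mul, Complex.norm_exp, Complex.norm_cpow_eq_rpow_re_of_pos hu',
      Real.norm_of_nonneg (Real.rpow_nonneg hu'.le _)]
    simp only [Complex.neg_re, Complex.ofReal_re, Complex.natCast_re]
    refine mul_le_mul_of_nonneg_right ?_ (Real.rpow_nonneg hu'.le _)
    rw [Real.exp_le_one_iff]
    linarith
  refine ((h4.mul h3).congr' ?_ ?_)
  · filter_upwards [self_mem_nhdsWithin] with u hu
    have hu' : (0 : ℝ) < u := hu
    have hu0 : (u : ℂ) ≠ 0 := Complex.ofReal_ne_zero.2 hu'.ne'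
    simp only [Function.comp_apply, zero_add]
    rw [← hφ u hu', FormalMultilinearSeries.partialSum, kernelRemainder, mul_sub]
    congr 1
    · rw [Complex.cpow_neg, Complex.cpow_natCast, Complex.exp_neg]
      field_simp [Complex.exp_ne_zero]
    · rw [Finset.mul_sum]
      refine Finset.sum_congr rfl fun k _ => ?_
      rw [FormalMultilinearSeries.apply_eq_pow_smul_coeff, smul_eq_mul, sub_eq_add_neg,
        Complex.cpow_add _ _ hu0, Complex.cpow_natCast]
      ring
  · filter_upwards [self_mem_nhdsWithin] with u hu
    have hu' : (0 : ℝ) < u := hu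
    simp only [Function.comp_apply, Complex.norm_real, Real.norm_of_nonneg hu'.le]
    rw [← Real.rpow_natCast, ← Real.rpow_add hu']
    congr 1
    ring

theorem continuousOn_ofReal_cpow (c : ℂ) :
    ContinuousOn (fun u : ℝ => (u : ℂ) ^ c) (Set.Ioi 0) := fun u hu =>
  (Complex.continuousAt_ofReal_cpow_const u c (Or.inr (ne_of_gt hu))).continuousWithinAt

theorem continuousOn_kernelRemainder {m : ℕ} (x : ℂ) {ω : Fin m → ℂ}
    (hω : ∀ i, 0 < (ω i).re) (d : ℕ → ℂ) (K : ℕ) :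
    ContinuousOn (kernelRemainder x ω d K) (Set.Ioi 0) := by
  unfold kernelRemainder barnesKernel
  refine ContinuousOn.sub (ContinuousOn.mul (Continuous.continuousOn (by fun_prop)) ?_) ?_
  · refine continuousOn_finsetProd _ fun i _ => ContinuousOn.inv₀
      (Continuous.continuousOn (by fun_prop)) fun u hu => one_sub_cexp_neg_mul_ne_zero (hω i) hu
  · refine continuousOn_finsetSum _ fun k _ => continuousOn_const.mul
      ((continuousOn_ofReal_cpow _).mul (Continuous.continuousOn (by fun_prop)))

theorem kernelRemainder_isBigO_atTop {m : ℕ} {x : ℂ} (hx : 0 < x.re) {ω : Fin m → ℂ}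
    (hω : ∀ i, 0 < (ω i).re) (d : ℕ → ℂ) (K : ℕ) (A : ℝ) :
    kernelRemainder x ω d K =O[atTop] fun u : ℝ => u ^ (-A) := by
  have hexp : ∀ w : ℂ, 0 < w.re → ∀ B : ℝ,
      (fun u : ℝ => Complex.exp (-(w * u))) =O[atTop] fun u : ℝ => u ^ B := by
    intro w hw B
    refine Asymptotics.IsBigO.trans (g := fun u : ℝ => Real.exp (-w.re * u)) ?_
      (isLittleO_exp_neg_mul_rpow_atTop hw B).isBigO
    refine Asymptotics.IsBigO.of_bound 1 (Eventually.of_forall fun u => ?_)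
    simp [Complex.norm_exp]
  refine Asymptotics.IsBigO.sub ?_ ?_
  · have h1 : Tendsto (fun u : ℝ => ∏ i, (1 - Complex.exp (-(ω i * u)))⁻¹) atTop (𝓝 1) := by
      have h2 : ∀ i, Tendsto (fun u : ℝ => (1 - Complex.exp (-(ω i * u)))⁻¹) atTop (𝓝 1) := by
        intro i
        have h3 : Tendsto (fun u : ℝ => Complex.exp (-(ω i * u))) atTop (𝓝 0) :=
          (hexp (ω i) (hω i) (-1)).trans_tendsto (tendsto_rpow_neg_atTop one_pos)
        simpa using (h3.const_sub 1).inv₀ (by simp)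
      simpa using tendsto_finsetProd Finset.univ fun i _ => h2 i
    simpa only [mul_one] using! (hexp x hx (-A)).mul (h1.isBigO_one ℝ)
  · refine Asymptotics.IsBigO.fun_sum fun k _ => Asymptotics.IsBigO.const_mul_left ?_ _
    have h1 : (fun u : ℝ => (u : ℂ) ^ ((k : ℂ) - m)) =O[atTop] fun u : ℝ => u ^ ((k : ℝ) - m) := by
      refine Asymptotics.IsBigO.of_bound 1 ?_
      filter_upwards [eventually_gt_atTop 0] with u hu
      rw [Complex.norm_cpow_eq_rpow_re_of_pos hu, Real.norm_of_nonneg (Real.rpow_nonneg hu.le _)]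
      simp
    have h2 := hexp 1 (by simp) (-A - ((k : ℝ) - m))
    simp only [one_mul] at h2
    refine (h1.mul h2).congr' EventuallyEq.rfl ?_
    filter_upwards [eventually_gt_atTop 0] with u hu
    rw [← Real.rpow_add hu]
    congr 1
    ring

theorem Gamma_add_natCast_eq_mul_prod {s : ℂ} (hs : 0 < s.re) (k : ℕ) :
    Complex.Gamma (s + k) = Complex.Gamma s * ∏ i ∈ Finset.range k, (s + i) := by
  induction k with
  | zero => simp
  | succ k ih =>
    have : s + k ≠ 0 := by
      intro h
      have := congrArg Complex.re h
      simp only [Complex.add_re, Complex.natCast_re, Complex.zero_re] at this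
      have hk : (0 : ℝ) ≤ k := Nat.cast_nonneg k
      linarith
    rw [Finset.prod_range_succ, ← mul_assoc, ← ih, Nat.cast_succ, ← add_assoc,
      Complex.Gamma_add_one _ this, mul_comm]

/-- The continuation of the Barnes zeta series to `Re t > m - K`. The quotient of products is
`Γ(t + k - m) / Γ(t)`, written as a rational function with poles in `{1, …, m}`. -/
def partialBarnesZeta {m : ℕ} (x : ℂ) (ω : Fin m → ℂ) (d : ℕ → ℂ) (K : ℕ) (t : ℂ) : ℂ :=
  (Complex.Gamma t)⁻¹ * mellin (kernelRemainder x ω d K) t +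
    ∑ k ∈ Finset.range K, d k * ((∏ i ∈ Finset.range k, (t - m + i)) /
      ∏ i ∈ Finset.range m, (t - m + i))

theorem differentiableAt_partialBarnesZeta {m : ℕ} {x : ℂ} (hx : 0 < x.re) {ω : Fin m → ℂ}
    (hω : ∀ i, 0 < (ω i).re) {d : ℕ → ℂ} {K : ℕ}
    (hd : kernelRemainder x ω d K =O[𝓝[>] 0] fun u : ℝ => u ^ ((K : ℝ) - m)) {t : ℂ}
    (ht : (m : ℝ) - K < t.re) (htm : ∀ k : ℕ, 1 ≤ k → k ≤ m → t ≠ k) :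
    DifferentiableAt ℂ (partialBarnesZeta x ω d K) t := by
  unfold partialBarnesZeta
  refine DifferentiableAt.add (DifferentiableAt.mul ?_ ?_) ?_
  · exact (Complex.differentiable_one_div_Gamma t)
  · refine mellin_differentiableAt_of_isBigO_rpow (a := t.re + 1) (b := (m : ℝ) - K)
      ((continuousOn_kernelRemainder x hω d K).locallyIntegrableOn measurableSet_Ioi)
      (kernelRemainder_isBigO_atTop hx hω d K _) (lt_add_one _) ?_ ht
    simpa using hd
  · refine DifferentiableAt.fun_sum fun k _ => (DifferentiableAt.div ?_ ?_ ?_).const_mul _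
    · exact DifferentiableAt.fun_finsetProd fun i _ => by fun_prop
    · exact DifferentiableAt.fun_finsetProd fun i _ => by fun_prop
    · refine Finset.prod_ne_zero_iff.2 fun i hi h => ?_
      have hi' := Finset.mem_range.1 hi
      refine htm (m - i) (by omega) (by omega) ?_
      rw [Nat.cast_sub hi'.le]
      linear_combination h

theorem partialBarnesZeta_eq_tsum {m : ℕ} {x : ℂ} (hx : 0 < x.re) {ω : Fin m → ℂ}
    (hω : ∀ i, 0 < (ω i).re) {d : ℕ → ℂ} {K : ℕ}
    (hd : kernelRemainder x ω d K =O[𝓝[>] 0] fun u : ℝ => u ^ ((K : ℝ) - m)) {t : ℂ}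
    (ht : (m : ℝ) < t.re) :
    partialBarnesZeta x ω d K t = ∑' n, (x + latticePoint ω n) ^ (-t) := by
  have ht0 : 0 < t.re := (Nat.cast_nonneg m).trans_lt ht
  have hΓ : Complex.Gamma t ≠ 0 := Complex.Gamma_ne_zero_of_re_pos ht0
  have hsum := hasSum_mellin_barnesKernel hx hω ht
  have h1 := (hsum.div_const (Complex.Gamma t)).tsum_eq
  simp_rw [mul_div_cancel_right₀ _ hΓ] at h1
  rw [h1]
  have hK : (m : ℝ) - K < t.re := by
    have : (0 : ℝ) ≤ K := Nat.cast_nonneg K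
    linarith
  have hrem : MellinConvergent (kernelRemainder x ω d K) t := by
    refine mellinConvergent_of_isBigO_rpow (a := t.re + 1) (b := (m : ℝ) - K)
      ((continuousOn_kernelRemainder x hω d K).locallyIntegrableOn measurableSet_Ioi)
      (kernelRemainder_isBigO_atTop hx hω d K _) (lt_add_one _) ?_ hK
    simpa using hd
  have hpos : ∀ k : ℕ, 0 < (t + ((k : ℂ) - m)).re := by
    intro k
    have : (0 : ℝ) ≤ k := Nat.cast_nonneg k
    simp only [Complex.add_re, Complex.sub_re, Complex.natCast_re]
    linarith
  have hterm : ∀ k : ℕ, HasMellin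
      (fun u : ℝ => (u : ℂ) ^ ((k : ℂ) - m) • Complex.exp (-u)) t
      (Complex.Gamma (t + ((k : ℂ) - m))) := by
    intro k
    have hc := mellinConvergent_cexp_neg_mul (hpos k) (z := 1) (by simp)
    have hv := mellin_cexp_neg_mul (hpos k) (z := 1) (by simp)
    simp only [one_mul, Complex.one_cpow] at hc hv
    exact ⟨MellinConvergent.cpow_smul.2 hc, by rw [mellin_cpow_smul, hv]⟩
  have hfin : ∀ L : ℕ, HasMellin
      (fun u : ℝ => ∑ k ∈ Finset.range L, d k * ((u : ℂ) ^ ((k : ℂ) - m) * Complex.exp (-u))) t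
      (∑ k ∈ Finset.range L, d k * Complex.Gamma (t + ((k : ℂ) - m))) := by
    intro L
    induction L with
    | zero =>
      simp only [Finset.range_zero, Finset.sum_empty]
      refine ⟨?_, by simp [mellin]⟩
      simp [MellinConvergent]
    | succ L ih =>
      simp only [Finset.sum_range_succ]
      have h2 := hasMellin_const_smul (hterm L).1 (d L)
      have h3 := hasMellin_add ih.1 h2.1
      rw [ih.2, h2.2, (hterm L).2] at h3
      exact h3
  have hadd := hasMellin_add hrem (hfin K).1
  have hker : (fun u : ℝ => kernelRemainder x ω d K u +
      ∑ k ∈ Finset.range K, d k * ((u : ℂ) ^ ((k : ℂ) - m) * Complex.exp (-u))) =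
      barnesKernel x ω := by
    ext u
    rw [kernelRemainder, sub_add_cancel]
  rw [hker] at hadd
  rw [hadd.2, (hfin K).2, partialBarnesZeta, add_div, Finset.sum_div, div_eq_inv_mul]
  congr 1
  refine Finset.sum_congr rfl fun k _ => ?_
  rw [mul_div_assoc]
  congr 1
  have hs : 0 < (t - m).re := by simpa using ht
  have e1 := Gamma_add_natCast_eq_mul_prod hs k
  have e2 := Gamma_add_natCast_eq_mul_prod hs m
  rw [sub_add_cancel] at e2
  have e3 : t + ((k : ℂ) - m) = t - m + k := by ring
  rw [e3, e1, e2, mul_div_mul_left]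
  exact Complex.Gamma_ne_zero_of_re_pos hs

theorem countable_barnesPoles (m : ℕ) : {t : ℂ | ∃ k : ℕ, 1 ≤ k ∧ k ≤ m ∧ t = k}.Countable :=
  by
  refine (Set.countable_range fun k : ℕ => (k : ℂ)).mono ?_
  rintro t ⟨k, _, _, h⟩
  exact ⟨k, h.symm⟩

theorem isOpen_halfPlane_diff_barnesPoles (A : ℝ) (m : ℕ) :
    IsOpen ({t : ℂ | A < t.re} \ {t : ℂ | ∃ k : ℕ, 1 ≤ k ∧ k ≤ m ∧ t = k}) := by
  refine (isOpen_lt continuous_const Complex.continuous_re).sdiff ?_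
  refine Set.Finite.isClosed (((Set.finite_Icc 1 m).image fun k : ℕ => (k : ℂ)).subset ?_)
  rintro t ⟨k, h1, h2, rfl⟩
  exact ⟨k, ⟨h1, h2⟩, rfl⟩

/-- Functions which are holomorphic on a half-plane minus the poles and agree far to the right are
equal. -/
theorem eqOn_halfPlane_diff_of_eqOn {A : ℝ} {m : ℕ} {f g : ℂ → ℂ}
    (hf : ∀ t : ℂ, A < t.re → (∀ k : ℕ, 1 ≤ k → k ≤ m → t ≠ k) → DifferentiableAt ℂ f t)
    (hg : ∀ t : ℂ, A < t.re → (∀ k : ℕ, 1 ≤ k → k ≤ m → t ≠ k) → DifferentiableAt ℂ g t)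
    (hfg : ∀ t : ℂ, (m : ℝ) < t.re → f t = g t) {t : ℂ} (ht : A < t.re)
    (htm : ∀ k : ℕ, 1 ≤ k → k ≤ m → t ≠ k) : f t = g t := by
  set U := {t : ℂ | A < t.re} \ {t : ℂ | ∃ k : ℕ, 1 ≤ k ∧ k ≤ m ∧ t = k} with hUdef
  have hU : IsOpen U := isOpen_halfPlane_diff_barnesPoles A m
  have hmem : ∀ s : ℂ, A < s.re → (∀ k : ℕ, 1 ≤ k → k ≤ m → s ≠ k) → s ∈ U :=
    fun s h1 h2 => ⟨h1, fun ⟨k, hk1, hk2, h⟩ => h2 k hk1 hk2 h⟩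
  have hmem' : ∀ s ∈ U, A < s.re ∧ ∀ k : ℕ, 1 ≤ k → k ≤ m → s ≠ k :=
    fun s hs => ⟨hs.1, fun k h1 h2 h => hs.2 ⟨k, h1, h2, h⟩⟩
  have han : ∀ F : ℂ → ℂ,
      (∀ t : ℂ, A < t.re → (∀ k : ℕ, 1 ≤ k → k ≤ m → t ≠ k) → DifferentiableAt ℂ F t) →
      AnalyticOnNhd ℂ F U := fun F hF =>
    DifferentiableOn.analyticOnNhd (fun s hs =>
      (hF s (hmem' s hs).1 (hmem' s hs).2).differentiableWithinAt) hU
  -- a point far to the right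
  set p : ℂ := ((max A m + 1 : ℝ) : ℂ) with hp
  have hpm : (m : ℝ) < p.re := by
    rw [hp, Complex.ofReal_re]; linarith [le_max_right A m]
  have hpU : p ∈ U := by
    refine hmem p (by rw [hp, Complex.ofReal_re]; linarith [le_max_left A m]) fun k _ hk h => ?_
    rw [h, Complex.natCast_re] at hpm
    have : (k : ℝ) ≤ m := by exact_mod_cast hk
    linarith
  refine (han f hf).eqOn_of_preconnected_of_eventuallyEq (han g hg)
    (isPreconnected_halfPlane_diff A (countable_barnesPoles m)) hpU ?_ (hmem t ht htm)
  filter_upwards [(isOpen_lt continuous_const Complex.continuous_re).mem_nhds hpm] with s hs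
  exact hfg s hs

/-- Continuations to the half-planes `Re t > m - K` for all `K` are glued together. -/
theorem exists_isBarnesZeta_of_re_pos {m : ℕ} {x : ℂ} (hx : 0 < x.re) {ω : Fin m → ℂ}
    (hω : ∀ i, 0 < (ω i).re) : ∃ Z, IsBarnesZeta x ω Z := by
  obtain ⟨d, hd⟩ := exists_kernelRemainder_isBigO x hω
  let κ : ℂ → ℕ := fun t => ⌊m - t.re⌋₊ + 1
  have hκ : ∀ t : ℂ, (m : ℝ) - κ t < t.re := by
    intro t
    have := Nat.lt_floor_add_one (m - t.re)
    simp only [κ, Nat.cast_add, Nat.cast_one]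
    linarith
  have hagree : ∀ K L : ℕ, ∀ t : ℂ, (m : ℝ) - K < t.re → (m : ℝ) - L < t.re →
      (∀ k : ℕ, 1 ≤ k → k ≤ m → t ≠ k) →
      partialBarnesZeta x ω d K t = partialBarnesZeta x ω d L t := by
    intro K L t hK hL ht
    refine eqOn_halfPlane_diff_of_eqOn (A := max ((m : ℝ) - K) ((m : ℝ) - L))
      (fun s h1 h2 => differentiableAt_partialBarnesZeta hx hω (hd K)
        ((le_max_left _ _).trans_lt h1) h2)
      (fun s h1 h2 => differentiableAt_partialBarnesZeta hx hω (hd L)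
        ((le_max_right _ _).trans_lt h1) h2) (fun s hs => ?_) (max_lt hK hL) ht
    rw [partialBarnesZeta_eq_tsum hx hω (hd K) hs, partialBarnesZeta_eq_tsum hx hω (hd L) hs]
  refine ⟨fun t => partialBarnesZeta x ω d (κ t) t, ?_, ?_⟩
  · intro t ht
    have hU : IsOpen ({s : ℂ | (m : ℝ) - κ t < s.re} \
        {s : ℂ | ∃ k : ℕ, 1 ≤ k ∧ k ≤ m ∧ s = k}) := isOpen_halfPlane_diff_barnesPoles _ m
    have htU : t ∈ {s : ℂ | (m : ℝ) - κ t < s.re} \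
        {s : ℂ | ∃ k : ℕ, 1 ≤ k ∧ k ≤ m ∧ s = k} :=
      ⟨hκ t, fun ⟨k, h1, h2, h⟩ => ht k h1 h2 h⟩
    have han : AnalyticOnNhd ℂ (partialBarnesZeta x ω d (κ t)) _ :=
      DifferentiableOn.analyticOnNhd (fun s hs =>
        (differentiableAt_partialBarnesZeta hx hω (hd (κ t)) hs.1
          fun k h1 h2 h => hs.2 ⟨k, h1, h2, h⟩).differentiableWithinAt) hU
    refine (han t htU).congr ?_
    filter_upwards [hU.mem_nhds htU] with s hs
    exact hagree _ _ s hs.1 (hκ s) fun k h1 h2 h => hs.2 ⟨k, h1, h2, h⟩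
  · intro t ht
    exact partialBarnesZeta_eq_tsum hx hω (hd _) ht

/-! ### Shifting the argument by a period -/

/-- The points of the cone with vanishing zeroth coordinate form the cone of the other periods, and
the remaining points form the cone shifted by the zeroth period. -/
theorem IsBarnesZeta.add_shift {m : ℕ} {x : ℂ} {ω : Fin (m + 1) → ℂ} (hω : ∀ i, 0 < (ω i).re)
    {Z W : ℂ → ℂ} (hZ : IsBarnesZeta (x + ω 0) ω Z) (hW : IsBarnesZeta x (Fin.tail ω) W) :
    IsBarnesZeta x ω (fun t => Z t + W t) := by
  refine ⟨(hZ.1.mono fun t ht => ht).add (hW.1.mono fun t ht k h1 h2 => ht k h1 (by omega)),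
    fun t ht => ?_⟩
  have ht' : (m : ℝ) < t.re := by push_cast at ht; linarith
  have hs := (summable_norm_cpow_latticePoint x hω ht).of_norm
  have hs1 := (summable_norm_cpow_latticePoint (x + ω 0) hω ht).of_norm
  beta_reduce
  rw [hZ.2 t ht, hW.2 t ht']
  change ∑' n, (x + ω 0 + latticePoint ω n) ^ (-t) + ∑' n, (x + latticePoint (Fin.tail ω) n) ^ (-t)
    = ∑' n, (x + latticePoint ω n) ^ (-t)
  let e := Fin.consEquiv fun _ : Fin (m + 1) => ℕ
  have hpt : ∀ (k : ℕ) (n : Fin m → ℕ), latticePoint ω (e (k, n)) =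
      k * ω 0 + latticePoint (Fin.tail ω) n := by
    intro k n
    simp [latticePoint, Fin.sum_univ_succ, e, Fin.consEquiv, Fin.tail]
  rw [← e.summable_iff] at hs hs1
  simp only [Function.comp_def] at hs hs1
  rw [← e.tsum_eq, ← e.tsum_eq (fun n => (x + latticePoint ω n) ^ (-t)), hs.tsum_prod,
    hs1.tsum_prod, hs.prod.tsum_eq_zero_add]
  simp only [hpt]
  rw [add_comm]
  congr 1
  · simp
  · refine tsum_congr fun k => tsum_congr fun n => ?_
    push_cast
    congr 1
    ring

/-- The Barnes zeta function exists for every argument: the difference equation of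
`IsBarnesZeta.add_shift` reduces to arguments in the right half-plane. -/
theorem exists_isBarnesZeta {m : ℕ} (x : ℂ) {ω : Fin m → ℂ} (hω : ∀ i, 0 < (ω i).re) :
    ∃ Z, IsBarnesZeta x ω Z := by
  induction m generalizing x with
  | zero =>
    by_cases hx : x = 0
    · refine ⟨fun _ => 0, analyticOnNhd_const, fun t ht => ?_⟩
      have : -t ≠ 0 := by
        intro h
        rw [neg_eq_zero.1 h] at ht
        simp at ht
      simp [hx, Complex.zero_cpow this]
    · refine ⟨fun t => x ^ (-t), ?_, fun t _ => by simp⟩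
      exact fun t _ => Differentiable.analyticAt (f := fun t : ℂ => x ^ (-t))
        (fun s => (differentiableAt_id.fun_neg).const_cpow (Or.inl hx)) t
  | succ m ih =>
    -- enough shifts by the zeroth period move `x` into the right half-plane
    have key : ∀ K : ℕ, ∀ x : ℂ, 0 < x.re + K * (ω 0).re → ∃ Z, IsBarnesZeta x ω Z := by
      intro K
      induction K with
      | zero => exact fun x hx => exists_isBarnesZeta_of_re_pos (by simpa using hx) hω
      | succ K hK =>
        intro x hx
        obtain ⟨Z, hZ⟩ := hK (x + ω 0) (by
          push_cast at hx
          rw [Complex.add_re]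
          linarith)
        obtain ⟨W, hW⟩ := ih x (ω := Fin.tail ω) fun i => hω i.succ
        exact ⟨_, hZ.add_shift hω hW⟩
    obtain ⟨K, hK⟩ := exists_nat_gt (-x.re / (ω 0).re)
    rw [div_lt_iff₀ (hω 0)] at hK
    exact key K x (by linarith)

theorem multipleGamma_eq_zero {m : ℕ} {x : ℂ} {ω : Fin m → ℂ}
    (h : ∃ n, x + latticePoint ω n = 0) : multipleGamma x ω = 0 := if_pos h

theorem multipleGamma_ne_zero {m : ℕ} {x : ℂ} {ω : Fin m → ℂ} (hω : ∀ i, 0 < (ω i).re)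
    (hx : ∀ n, x + latticePoint ω n ≠ 0) : multipleGamma x ω ≠ 0 := by
  obtain ⟨Z, hZ⟩ := exists_isBarnesZeta x hω
  rw [multipleGamma_eq hx hZ]
  exact Complex.exp_ne_zero _

theorem IsBarnesZeta.differentiableAt_zero {m : ℕ} {x : ℂ} {ω : Fin m → ℂ} {Z : ℂ → ℂ}
    (hZ : IsBarnesZeta x ω Z) : DifferentiableAt ℂ Z 0 := by
  refine (hZ.1 0 fun k h1 _ h => ?_).differentiableAt
  have : k = 0 := by exact_mod_cast h.symm
  omega

/-- The difference equation `Γ_{m+1}(x) = Γ_{m+1}(x + ω₀) Γₘ(x)`; it holds at the poles as well,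
because the value `0` given to the left-hand side there is also a value of one of the factors. -/
theorem multipleGamma_eq_mul_shift {m : ℕ} (x : ℂ) {ω : Fin (m + 1) → ℂ}
    (hω : ∀ i, 0 < (ω i).re) :
    multipleGamma x ω = multipleGamma (x + ω 0) ω * multipleGamma x (Fin.tail ω) := by
  have hpt : ∀ n : Fin (m + 1) → ℕ, latticePoint ω n =
      n 0 * ω 0 + latticePoint (Fin.tail ω) (Fin.tail n) := fun n => by
    simp [latticePoint, Fin.sum_univ_succ, Fin.tail]
  by_cases hx : ∃ n, x + latticePoint ω n = 0
  · rw [multipleGamma_eq_zero hx]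
    obtain ⟨n, hn⟩ := hx
    rw [hpt] at hn
    rcases Nat.eq_zero_or_pos (n 0) with h0 | h0
    · rw [multipleGamma_eq_zero (ω := Fin.tail ω), mul_zero]
      exact ⟨Fin.tail n, by rw [h0] at hn; simpa using hn⟩
    · rw [multipleGamma_eq_zero (x := x + ω 0), zero_mul]
      refine ⟨Fin.cons (n 0 - 1) (Fin.tail n), ?_⟩
      rw [hpt]
      simp only [Fin.cons_zero, Fin.tail_cons]
      rw [Nat.cast_sub h0, Nat.cast_one]
      linear_combination hn
  · push Not at hx
    have hx1 : ∀ n, x + ω 0 + latticePoint ω n ≠ 0 := by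
      intro n h
      refine hx (Fin.cons (n 0 + 1) (Fin.tail n)) ?_
      rw [hpt] at h ⊢
      simp only [Fin.cons_zero, Fin.tail_cons]
      push_cast
      linear_combination h
    have hx2 : ∀ n, x + latticePoint (Fin.tail ω) n ≠ 0 := by
      intro n h
      refine hx (Fin.cons 0 n) ?_
      rw [hpt]
      simpa using h
    obtain ⟨Z, hZ⟩ := exists_isBarnesZeta (x + ω 0) hω
    obtain ⟨W, hW⟩ := exists_isBarnesZeta x (ω := Fin.tail ω) fun i => hω i.succ
    rw [multipleGamma_eq hx (hZ.add_shift hω hW), multipleGamma_eq hx1 hZ, multipleGamma_eq hx2 hW,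
      deriv_fun_add hZ.differentiableAt_zero hW.differentiableAt_zero, Complex.exp_add]

/-! ### Balanced products of multiple gamma functions -/

/-- Far out in the cone a fixed finite set of shifts is small compared with the real part. -/
theorem eventually_cone_radius {m : ℕ} {ω : Fin m → ℂ} (hω : ∀ i, 0 < (ω i).re) {J : Type*}
    [Fintype J] (a : J → ℂ) :
    ∃ c > 0, ∀ᶠ n in cofinite, c * height n ≤ (latticePoint ω n).re / 2 ∧
      1 ≤ (latticePoint ω n).re / 2 ∧ ∀ j, ‖a j‖ < (latticePoint ω n).re / 2 := by
  obtain ⟨c, hc, h⟩ := exists_eventually_height_le_re hω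
  refine ⟨c / 2, by positivity, ?_⟩
  have hS : 0 ≤ ∑ j, ‖a j‖ := Finset.sum_nonneg fun j _ => norm_nonneg _
  filter_upwards [h (2 * (1 + ∑ j, ‖a j‖))] with n hn
  have h1 : 0 < c * height n := mul_pos hc (height_pos n)
  refine ⟨by linarith, by linarith, fun j => ?_⟩
  have h2 := Finset.single_le_sum (f := fun j => ‖a j‖) (fun j _ => norm_nonneg (a j))
    (Finset.mem_univ j)
  linarith

theorem half_re_le_re_add {y w : ℂ} (hw : w ∈ Metric.ball (0 : ℂ) (y.re / 2)) :
    y.re / 2 ≤ (y + w).re := by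
  have h1 := (Complex.abs_re_le_norm w).trans (mem_ball_zero_iff.1 hw).le
  rw [Complex.add_re]
  linarith [(abs_le.1 h1).1]

/-- Weights whose moments of orders `0, …, m` vanish improve the decay of the terms of the Barnes
series by `m + 1` orders, so that the series converges beyond `t = 0`. -/
theorem exists_summable_bound_sum_cpow {m : ℕ} {ω : Fin m → ℂ} (hω : ∀ i, 0 < (ω i).re)
    {J : Type*} [Fintype J] {a ε : J → ℂ} (hε : ∀ k ≤ m, ∑ j, ε j * a j ^ k = 0)
    (ha : ∀ j n, a j + latticePoint ω n ≠ 0) (T : ℝ) :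
    ∃ u : (Fin m → ℕ) → ℝ, Summable u ∧ ∀ n, ∀ t : ℂ, -(1 / 2) < t.re → ‖t‖ ≤ T →
      ‖∑ j, ε j * (a j + latticePoint ω n) ^ (-t)‖ ≤ u n := by
  classical
  obtain ⟨c, hc, hcone⟩ := eventually_cone_radius hω a
  obtain ⟨C, hC, hnorm⟩ := exists_norm_le_height ω 0
  simp only [zero_add] at hnorm
  set S := ∑ j, ‖ε j‖ * ‖a j‖ ^ (m + 1)
  have hS : 0 ≤ S := Finset.sum_nonneg fun j _ => by positivity
  set B := (2 / c) ^ (m + 1) * ((2 * C) ^ (1 / 2 : ℝ) * Real.exp (Real.pi * T)) * S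
  -- the explicit bound for the points outside the finite exceptional set
  have hgood : ∀ n, (c * height n ≤ (latticePoint ω n).re / 2 ∧
      1 ≤ (latticePoint ω n).re / 2 ∧ ∀ j, ‖a j‖ < (latticePoint ω n).re / 2) →
      ∀ t : ℂ, -(1 / 2) < t.re → ‖t‖ ≤ T →
      ‖∑ j, ε j * (a j + latticePoint ω n) ^ (-t)‖ ≤ B * height n ^ (-((m : ℝ) + 1 / 2)) := by
    rintro n ⟨h1, h2, h3⟩ t ht htT
    set y := latticePoint ω n
    have hh := height_pos n
    have hy : ‖y‖ ≤ C * height n := hnorm n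
    have hR : 0 < y.re / 2 := by linarith
    have hslit : ∀ w ∈ Metric.ball (0 : ℂ) (y.re / 2), 1 ≤ (w + y).re := fun w hw => by
      rw [add_comm]
      exact h2.trans (half_re_le_re_add hw)
    have key := norm_sum_mul_le_of_moments (k := m + 1) (ε := ε) (a := a)
      (f := fun w => (w + y) ^ (-t)) (R := y.re / 2)
      (M := (2 * C * height n) ^ (1 / 2 : ℝ) * Real.exp (Real.pi * T))
      (fun i hi => hε i (by omega)) hR ?_ ?_ fun j => mem_ball_zero_iff.2 (h3 j)
    · refine key.trans ?_
      rw [Real.mul_rpow (by positivity) hh.le]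
      have e1 : (2 / (y.re / 2)) ^ (m + 1) ≤ (2 / c) ^ (m + 1) * (height n ^ (m + 1))⁻¹ := by
        rw [← inv_pow, ← mul_pow]
        refine pow_le_pow_left₀ (by positivity) ?_ _
        rw [← div_eq_mul_inv, div_div]
        exact div_le_div_of_nonneg_left (by norm_num) (by positivity) h1
      have e2 : height n ^ (-((m : ℝ) + 1 / 2)) =
          (height n ^ (m + 1))⁻¹ * height n ^ (1 / 2 : ℝ) := by
        rw [← Real.rpow_natCast, ← Real.rpow_neg hh.le, ← Real.rpow_add hh]
        congr 1
        push_cast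
        ring
      calc _ ≤ ((2 / c) ^ (m + 1) * (height n ^ (m + 1))⁻¹) *
            ((2 * C) ^ (1 / 2 : ℝ) * height n ^ (1 / 2 : ℝ) * Real.exp (Real.pi * T)) * S := by
            gcongr
        _ = _ := by rw [e2]; ring
    · intro w hw
      refine DifferentiableAt.differentiableWithinAt ?_
      exact (differentiableAt_id.add_const y).cpow_const (Or.inl (by
        have := hslit w hw
        simp only [id]
        linarith))
    · intro w hw
      have hw1 := hslit w hw
      have hn1 : 1 ≤ ‖w + y‖ := hw1.trans (Complex.re_le_norm _)
      have hne : w + y ≠ 0 := norm_pos_iff.1 (by linarith)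
      rw [Complex.norm_cpow_of_ne_zero hne, Complex.neg_re, Complex.neg_im, div_eq_mul_inv,
        ← Real.exp_neg]
      have hle : ‖w + y‖ ≤ 2 * C * height n := by
        have hw2 := (mem_ball_zero_iff.1 hw).le
        have hre := Complex.re_le_norm y
        calc ‖w + y‖ ≤ ‖w‖ + ‖y‖ := norm_add_le _ _
          _ ≤ 2 * C * height n := by linarith [norm_nonneg y]
      have f1 : ‖w + y‖ ^ (-t.re) ≤ (2 * C * height n) ^ (1 / 2 : ℝ) :=
        (Real.rpow_le_rpow_of_exponent_le hn1 (by linarith)).trans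
          (Real.rpow_le_rpow (norm_nonneg _) hle (by norm_num))
      have f2 : Real.exp (-(Complex.arg (w + y) * -t.im)) ≤ Real.exp (Real.pi * T) := by
        rw [Real.exp_le_exp]
        calc -(Complex.arg (w + y) * -t.im) = Complex.arg (w + y) * t.im := by ring
          _ ≤ |Complex.arg (w + y) * t.im| := le_abs_self _
          _ = |Complex.arg (w + y)| * |t.im| := abs_mul _ _
          _ ≤ _ := mul_le_mul (Complex.abs_arg_le_pi _) ((Complex.abs_im_le_norm t).trans htT)
              (abs_nonneg _) Real.pi_pos.le
      exact mul_le_mul f1 f2 (Real.exp_pos _).le (by positivity)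
  have hany : ∀ n, ∀ t : ℂ, ‖t‖ ≤ T → ‖∑ j, ε j * (a j + latticePoint ω n) ^ (-t)‖ ≤
      ∑ j, ‖ε j‖ * Real.exp (‖Complex.log (a j + latticePoint ω n)‖ * T) := by
    intro n t htT
    refine (norm_sum_le _ _).trans (Finset.sum_le_sum fun j _ => ?_)
    rw [norm_mul, Complex.cpow_def_of_ne_zero (ha j n), Complex.norm_exp]
    refine mul_le_mul_of_nonneg_left (Real.exp_le_exp.2 ?_) (norm_nonneg _)
    refine (Complex.re_le_norm _).trans ?_
    rw [norm_mul, norm_neg]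
    exact mul_le_mul_of_nonneg_left htT (norm_nonneg _)
  refine ⟨fun n => if (c * height n ≤ (latticePoint ω n).re / 2 ∧
      1 ≤ (latticePoint ω n).re / 2 ∧ ∀ j, ‖a j‖ < (latticePoint ω n).re / 2)
      then B * height n ^ (-((m : ℝ) + 1 / 2))
      else ∑ j, ‖ε j‖ * Real.exp (‖Complex.log (a j + latticePoint ω n)‖ * T), ?_, ?_⟩
  · refine ((summable_height_rpow (m := m) (σ := (m : ℝ) + 1 / 2) (by linarith)).mul_left
      B).congr_cofinite ?_
    filter_upwards [hcone] with n hn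
    rw [if_pos hn]
  · intro n t ht htT
    beta_reduce
    split_ifs with h
    · exact hgood n h t ht htT
    · exact hany n t htT

/-- If the moments of orders `0, …, m` of the exponents vanish, the corresponding product of
powers of multiple gamma functions is an absolutely convergent product over the cone. The
combination of Barnes zeta functions is given by a convergent series around `t = 0`, which may be
differentiated term by term. -/
theorem hasProd_multipleGamma {m : ℕ} {ω : Fin m → ℂ} (hω : ∀ i, 0 < (ω i).re)
    {J : Type*} [Fintype J] {a : J → ℂ} {ε : J → ℤ}
    (hε : ∀ k ≤ m, ∑ j, (ε j : ℂ) * a j ^ k = 0)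
    (ha : ∀ j n, a j + latticePoint ω n ≠ 0) :
    HasProd (fun n => ∏ j, (a j + latticePoint ω n) ^ ε j)
      (∏ j, multipleGamma (a j) ω ^ (-ε j)) := by
  choose Z hZ using fun j => exists_isBarnesZeta (a j) hω
  set F : (Fin m → ℕ) → ℂ → ℂ := fun n t => ∑ j, (ε j : ℂ) * (a j + latticePoint ω n) ^ (-t)
  set D : ℂ → ℂ := fun t => ∑' n, F n t with hD
  have hFder : ∀ n t, HasDerivAt (F n) (∑ j, (ε j : ℂ) *
      ((a j + latticePoint ω n) ^ (-t) * Complex.log (a j + latticePoint ω n) * -1)) t := by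
    intro n t
    refine HasDerivAt.fun_sum fun j _ => HasDerivAt.const_mul _ ?_
    exact ((hasDerivAt_id t).fun_neg).const_cpow (Or.inl (ha j n))
  have hopen : ∀ T : ℝ, IsOpen ({t : ℂ | -(1 / 2) < t.re} ∩ Metric.ball 0 T) := fun T =>
    (isOpen_lt continuous_const Complex.continuous_re).inter Metric.isOpen_ball
  have hDdiff : ∀ t : ℂ, -(1 / 2) < t.re → DifferentiableAt ℂ D t := by
    intro t ht
    obtain ⟨u, hu, hub⟩ := exists_summable_bound_sum_cpow hω hε ha (‖t‖ + 1)
    refine (Complex.differentiableOn_tsum_of_summable_norm hu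
      (fun n s _ => (hFder n s).differentiableAt.differentiableWithinAt) (hopen (‖t‖ + 1))
      fun n s hs => hub n s hs.1 (mem_ball_zero_iff.1 hs.2).le).differentiableAt
      ((hopen (‖t‖ + 1)).mem_nhds ⟨ht, mem_ball_zero_iff.2 (lt_add_one _)⟩)
  have hZD : ∀ t : ℂ, (m : ℝ) < t.re → D t = ∑ j, (ε j : ℂ) * Z j t := by
    intro t ht
    rw [hD]
    have hs : ∀ j, Summable fun n => (ε j : ℂ) * (a j + latticePoint ω n) ^ (-t) := fun j =>
      (summable_norm_cpow_latticePoint (a j) hω ht).of_norm.mul_left _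
    simp only [F]
    rw [Summable.tsum_finsetSum fun j _ => hs j]
    refine Finset.sum_congr rfl fun j _ => ?_
    rw [tsum_mul_left, (hZ j).2 t ht]
    rfl
  have h0 : (0 : ℂ) ∈ {t : ℂ | -(1 / 2) < t.re} ∩ Metric.ball 0 1 :=
    ⟨by norm_num, Metric.mem_ball_self one_pos⟩
  have hm0 : ∀ s ∈ Metric.ball (0 : ℂ) 1, ∀ k : ℕ, 1 ≤ k → k ≤ m → s ≠ k := by
    intro s hs k hk _ h
    rw [h, mem_ball_zero_iff, Complex.norm_natCast] at hs
    have : (1 : ℝ) ≤ k := by exact_mod_cast hk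
    linarith
  have hev : D =ᶠ[𝓝 0] fun t => ∑ j, (ε j : ℂ) * Z j t := by
    filter_upwards [(hopen 1).mem_nhds h0] with s hs
    refine eqOn_halfPlane_diff_of_eqOn (A := -(1 / 2)) (fun t ht _ => hDdiff t ht)
      (fun t _ htm => ?_) hZD hs.1 (hm0 s hs.2)
    exact DifferentiableAt.fun_sum fun j _ => ((hZ j).1 t htm).differentiableAt.const_mul _
  have hderD : deriv D 0 = ∑ j, (ε j : ℂ) * deriv (Z j) 0 := by
    rw [hev.deriv_eq]
    exact (HasDerivAt.fun_sum fun j _ =>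
      ((hZ j).differentiableAt_zero.hasDerivAt.const_mul _)).deriv
  obtain ⟨u, hu, hub⟩ := exists_summable_bound_sum_cpow hω hε ha 1
  have hsum := Complex.hasSum_deriv_of_summable_norm hu
    (fun n s _ => (hFder n s).differentiableAt.differentiableWithinAt) (hopen 1)
    (fun n s hs => hub n s hs.1 (mem_ball_zero_iff.1 hs.2).le) h0
  have hprod := hsum.neg.cexp
  convert! hprod using 1
  · ext n
    simp only [Function.comp_apply]
    rw [(hFder n 0).deriv, ← Finset.sum_neg_distrib, Complex.exp_sum]
    refine Finset.prod_congr rfl fun j _ => ?_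
    rw [neg_zero, Complex.cpow_zero, one_mul, mul_neg_one, mul_neg, neg_neg, Complex.exp_int_mul,
      Complex.exp_log (ha j n)]
  · change _ = Complex.exp (-deriv D 0)
    rw [hderD, ← Finset.sum_neg_distrib, Complex.exp_sum]
    refine Finset.prod_congr rfl fun j _ => ?_
    rw [multipleGamma_eq (ha j) (hZ j), ← Complex.exp_int_mul]
    congr 1
    push_cast
    ring

/-- At a pole of one of the gamma functions both sides are `0`: an infinite product with a zero
factor vanishes, and so does every nonzero power of `0`. -/
theorem prod_multipleGamma_eq_tprod {m : ℕ} {ω : Fin m → ℂ} (hω : ∀ i, 0 < (ω i).re)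
    {J : Type*} [Fintype J] {a : J → ℂ} {ε : J → ℤ}
    (hε : ∀ k ≤ m, ∑ j, (ε j : ℂ) * a j ^ k = 0) (hne : ∀ j, ε j ≠ 0) :
    ∏ j, multipleGamma (a j) ω ^ (-ε j) = ∏' n, ∏ j, (a j + latticePoint ω n) ^ ε j := by
  by_cases ha : ∀ j n, a j + latticePoint ω n ≠ 0
  · exact (hasProd_multipleGamma hω hε ha).tprod_eq.symm
  · push Not at ha
    obtain ⟨j, n, hn⟩ := ha
    have h0 : ∏ i, (a i + latticePoint ω n) ^ ε i = 0 :=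
      Finset.prod_eq_zero (Finset.mem_univ j) (by rw [hn, zero_zpow _ (hne j)])
    rw [tprod_of_exists_eq_zero ⟨n, h0⟩]
    refine Finset.prod_eq_zero (Finset.mem_univ j) ?_
    rw [multipleGamma_eq_zero ⟨n, hn⟩, zero_zpow _ (neg_ne_zero.2 (hne j))]

/-! ### Scaling limit of balanced `q`-products -/

theorem one_sub_cexp_mem_slitPlane {v : ℂ} (hv : 0 < v.re) :
    1 - Complex.exp (-v) ∈ Complex.slitPlane := by
  rw [sub_eq_add_neg]
  refine Complex.mem_slitPlane_of_norm_lt_one ?_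
  rw [norm_neg, Complex.norm_exp, Real.exp_lt_one_iff, Complex.neg_re]
  linarith

theorem norm_cexp_div_one_sub_cexp_le {v : ℂ} (hv : 0 < v.re) :
    ‖Complex.exp (-v) / (1 - Complex.exp (-v))‖ ≤ 1 / v.re := by
  have h1 : ‖Complex.exp (-v)‖ = Real.exp (-v.re) := by rw [Complex.norm_exp, Complex.neg_re]
  have h2 : 1 - Real.exp (-v.re) ≤ ‖1 - Complex.exp (-v)‖ := by
    have := norm_sub_norm_le 1 (Complex.exp (-v))
    rwa [norm_one, h1] at this
  have h3 : v.re * Real.exp (-v.re) ≤ 1 - Real.exp (-v.re) := by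
    have h4 := mul_le_mul_of_nonneg_right (Real.add_one_le_exp v.re) (Real.exp_pos (-v.re)).le
    rw [← Real.exp_add, add_neg_cancel, Real.exp_zero] at h4
    linarith
  have h5 : 0 < v.re * Real.exp (-v.re) := mul_pos hv (Real.exp_pos _)
  rw [norm_div, h1, div_le_div_iff₀ (by linarith) hv]
  linarith

/-- The logarithmic derivative of `1 - e^{-yl}` in `y` is at most `1 / Re y`, uniformly in
`l > 0`. -/
theorem norm_log_one_sub_cexp_sub_le {y : ℂ} (hy : 0 < y.re) {l : ℝ} (hl : 0 < l) :
    DifferentiableOn ℂ (fun w => Complex.log (1 - Complex.exp (-((w + y) * l))) -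
        Complex.log (1 - Complex.exp (-(y * l)))) (Metric.ball 0 (y.re / 2)) ∧
      ∀ w ∈ Metric.ball (0 : ℂ) (y.re / 2),
        ‖Complex.log (1 - Complex.exp (-((w + y) * l))) -
          Complex.log (1 - Complex.exp (-(y * l)))‖ ≤ 1 := by
  have hre : ∀ w ∈ Metric.ball (0 : ℂ) (y.re / 2), y.re / 2 ≤ (w + y).re := fun w hw => by
    rw [add_comm]
    exact half_re_le_re_add hw
  have hre' : ∀ w ∈ Metric.ball (0 : ℂ) (y.re / 2), 0 < ((w + y) * l).re := fun w hw => by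
    rw [Complex.re_mul_ofReal]
    exact mul_pos (lt_of_lt_of_le (by linarith) (hre w hw)) hl
  have hder : ∀ w ∈ Metric.ball (0 : ℂ) (y.re / 2), HasDerivAt
      (fun w => Complex.log (1 - Complex.exp (-((w + y) * l))))
      ((l : ℂ) * (Complex.exp (-((w + y) * l)) / (1 - Complex.exp (-((w + y) * l))))) w := by
    intro w hw
    have h1 : HasDerivAt (fun w : ℂ => -((w + y) * (l : ℂ))) (-(l : ℂ)) w := by
      simpa using (((hasDerivAt_id w).add_const y).mul_const (l : ℂ)).fun_neg
    have h2 := (h1.cexp.const_sub 1).clog (one_sub_cexp_mem_slitPlane (hre' w hw))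
    convert! h2 using 1
    ring
  refine ⟨fun w hw => ((hder w hw).differentiableAt.sub_const _).differentiableWithinAt,
    fun w hw => ?_⟩
  have h0 : (0 : ℂ) ∈ Metric.ball (0 : ℂ) (y.re / 2) := Metric.mem_ball_self (by linarith)
  have hmv := (convex_ball (0 : ℂ) (y.re / 2)).norm_image_sub_le_of_norm_hasDerivWithin_le
    (C := 2 / y.re) (fun w hw => (hder w hw).hasDerivWithinAt) (fun w hw => ?_) h0 hw
  · simp only [zero_add, sub_zero] at hmv
    refine hmv.trans ?_
    have h1 := (mem_ball_zero_iff.1 hw).le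
    rw [div_mul_eq_mul_div, div_le_one hy]
    linarith
  · rw [norm_mul, Complex.norm_real, Real.norm_of_nonneg hl.le]
    have h1 := norm_cexp_div_one_sub_cexp_le (hre' w hw)
    rw [Complex.re_mul_ofReal] at h1
    have h2 := hre w hw
    have h3 : 0 < (w + y).re := by linarith
    calc l * _ ≤ l * (1 / ((w + y).re * l)) := mul_le_mul_of_nonneg_left h1 hl.le
      _ = 1 / (w + y).re := by field_simp
      _ ≤ 1 / (y.re / 2) := one_div_le_one_div_of_le (by linarith) h2
      _ = 2 / y.re := one_div_div _ _

/-- A bound for the factors of a balanced `q`-product, valid for almost all lattice points and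
uniform in the scale `l`. -/
theorem exists_bound_prod_one_sub_cexp {m : ℕ} {ω : Fin m → ℂ} (hω : ∀ i, 0 < (ω i).re)
    {J : Type*} [Fintype J] {a : J → ℂ} {ε : J → ℤ}
    (hε : ∀ k ≤ m, ∑ j, (ε j : ℂ) * a j ^ k = 0) :
    ∃ B : ℝ, ∀ᶠ n in cofinite, (∀ j, 0 < (a j + latticePoint ω n).re) ∧ ∀ l : ℝ, 0 < l →
      ‖∏ j, (1 - Complex.exp (-((a j + latticePoint ω n) * l))) ^ ε j - 1‖ ≤
        B * height n ^ (-((m : ℝ) + 1)) := by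
  obtain ⟨c, hc, hcone⟩ := eventually_cone_radius hω a
  set S := ∑ j, ‖(ε j : ℂ)‖ * ‖a j‖ ^ (m + 1)
  have hS : 0 ≤ S := Finset.sum_nonneg fun j _ => by positivity
  set B := (2 / c) ^ (m + 1) * S
  have hsmall := (((summable_height_rpow (m := m) (σ := (m : ℝ) + 1) (by linarith)).mul_left
    B).tendsto_cofinite_zero).eventually_le_const one_pos
  refine ⟨2 * B, ?_⟩
  filter_upwards [hcone, hsmall] with n ⟨h1, h2, h3⟩ h4
  set y := latticePoint ω n
  have hh := height_pos n
  have hy : 0 < y.re := by linarith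
  have hmem : ∀ j, a j ∈ Metric.ball (0 : ℂ) (y.re / 2) := fun j => mem_ball_zero_iff.2 (h3 j)
  have hre : ∀ j, 0 < (a j + y).re := fun j => by
    rw [add_comm]
    exact lt_of_lt_of_le (by linarith) (half_re_le_re_add (hmem j))
  refine ⟨hre, fun l hl => ?_⟩
  obtain ⟨hd, hb⟩ := norm_log_one_sub_cexp_sub_le hy hl
  have key := norm_sum_mul_le_of_moments (k := m + 1) (ε := fun j => (ε j : ℂ)) (a := a)
    (fun i hi => hε i (by omega)) (by linarith) hd hb hmem
  have h0 : ∑ j, (ε j : ℂ) = 0 := by simpa using hε 0 (Nat.zero_le m)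
  simp_rw [mul_sub] at key
  rw [Finset.sum_sub_distrib, ← Finset.sum_mul, h0, zero_mul, sub_zero, mul_one] at key
  have e1 : (2 / (y.re / 2)) ^ (m + 1) ≤ (2 / c) ^ (m + 1) * height n ^ (-((m : ℝ) + 1)) := by
    have : height n ^ (-((m : ℝ) + 1)) = (height n ^ (m + 1))⁻¹ := by
      rw [Real.rpow_neg hh.le, ← Real.rpow_natCast]
      push_cast
      rfl
    rw [this, ← inv_pow, ← mul_pow]
    refine pow_le_pow_left₀ (by positivity) ?_ _
    rw [← div_eq_mul_inv, div_div]
    exact div_le_div_of_nonneg_left (by norm_num) (by positivity) h1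
  have key2 : ‖∑ j, (ε j : ℂ) * Complex.log (1 - Complex.exp (-((a j + y) * l)))‖ ≤
      B * height n ^ (-((m : ℝ) + 1)) := by
    refine key.trans ((mul_le_mul_of_nonneg_right e1 hS).trans (le_of_eq ?_))
    ring
  have e2 : ∏ j, (1 - Complex.exp (-((a j + y) * l))) ^ ε j =
      Complex.exp (∑ j, (ε j : ℂ) * Complex.log (1 - Complex.exp (-((a j + y) * l)))) := by
    rw [Complex.exp_sum]
    refine Finset.prod_congr rfl fun j _ => ?_
    rw [Complex.exp_int_mul, Complex.exp_log]
    refine Complex.slitPlane_ne_zero (one_sub_cexp_mem_slitPlane ?_)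
    rw [Complex.re_mul_ofReal]
    exact mul_pos (hre j) hl
  rw [e2, mul_assoc]
  exact (Complex.norm_exp_sub_one_le (key2.trans h4)).trans
    (mul_le_mul_of_nonneg_left key2 zero_le_two)

theorem tendsto_one_sub_cexp_div (u : ℂ) :
    Tendsto (fun l : ℝ => (1 - Complex.exp (-(u * l))) / l) (𝓝[>] 0) (𝓝 u) := by
  have h1 : HasDerivAt (fun v : ℂ => 1 - Complex.exp (-(u * v))) u 0 := by
    have h2 : HasDerivAt (fun v : ℂ => -(u * v)) (-u) 0 := by
      simpa using ((hasDerivAt_id (0 : ℂ)).const_mul u).fun_neg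
    simpa using (h2.cexp).const_sub 1
  have h3 := h1.tendsto_slope
  have h4 : Tendsto (fun l : ℝ => (l : ℂ)) (𝓝[>] 0) (𝓝[≠] 0) := by
    refine tendsto_nhdsWithin_iff.2 ⟨?_, ?_⟩
    · have := Complex.continuous_ofReal.tendsto 0
      rw [Complex.ofReal_zero] at this
      exact this.mono_left nhdsWithin_le_nhds
    · filter_upwards [self_mem_nhdsWithin] with l hl
      exact Complex.ofReal_ne_zero.2 (ne_of_gt hl)
  refine (h3.comp h4).congr fun l => ?_
  simp [slope_def_field]

/-- Since the exponents sum to `0`, the powers of `l` in `1 - e^{-ul} ~ u l` cancel. -/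
theorem tendsto_prod_one_sub_cexp {J : Type*} [Fintype J] {u : J → ℂ} {ε : J → ℤ}
    (hε : ∑ j, ε j = 0) (hu : ∀ j, ε j < 0 → u j ≠ 0) :
    Tendsto (fun l : ℝ => ∏ j, (1 - Complex.exp (-(u j * l))) ^ ε j) (𝓝[>] 0)
      (𝓝 (∏ j, u j ^ ε j)) := by
  have h1 : Tendsto (fun l : ℝ => ∏ j, ((1 - Complex.exp (-(u j * l))) / l) ^ ε j) (𝓝[>] 0)
      (𝓝 (∏ j, u j ^ ε j)) := by
    refine tendsto_finsetProd _ fun j _ => (tendsto_one_sub_cexp_div (u j)).zpow₀ _ ?_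
    rcases lt_or_ge (ε j) 0 with h | h
    · exact Or.inl (hu j h)
    · exact Or.inr h
  refine h1.congr' ?_
  filter_upwards [self_mem_nhdsWithin] with l hl
  have hl0 : (l : ℂ) ≠ 0 := Complex.ofReal_ne_zero.2 (ne_of_gt hl)
  simp_rw [div_zpow]
  rw [Finset.prod_div_distrib]
  have hsum : ∀ s : Finset J, ∏ j ∈ s, (l : ℂ) ^ ε j = (l : ℂ) ^ ∑ j ∈ s, ε j := by
    classical
    intro s
    induction s using Finset.induction_on with
    | empty => simp
    | insert j s hj ih => rw [Finset.prod_insert hj, Finset.sum_insert hj, zpow_add₀ hl0, ih]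
  have : ∏ j, (l : ℂ) ^ ε j = 1 := by
    rw [hsum, hε, zpow_zero]
  rw [this, div_one]

theorem summable_norm_cexp_latticePoint {m : ℕ} {ω : Fin m → ℂ} (hω : ∀ i, 0 < (ω i).re) (a : ℂ)
    {l : ℝ} (hl : 0 < l) :
    Summable fun n => ‖-Complex.exp (-((a + latticePoint ω n) * l))‖ := by
  have h := (hasSum_pi_prod (f := fun i k => Complex.exp (-(ω i * l)) ^ k)
    (s := fun i => (1 - Complex.exp (-(ω i * l)))⁻¹)
    (fun i => hasSum_geometric_of_norm_lt_one (norm_cexp_neg_mul_lt_one (hω i) hl))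
    (fun i => by
      simp_rw [norm_pow]
      exact summable_geometric_of_lt_one (norm_nonneg _)
        (norm_cexp_neg_mul_lt_one (hω i) hl))).2
  refine (h.mul_left ‖Complex.exp (-(a * l))‖).congr fun n => ?_
  rw [← cexp_latticePoint, ← norm_mul, ← Complex.exp_add, norm_neg]
  congr 2
  ring

/-- The product `(e^{-al}; e^{-ω₁l}, …, e^{-ωₘl})_∞` in additive notation. -/
def expProd {m : ℕ} (ω : Fin m → ℂ) (l : ℝ) (a : ℂ) : ℂ :=
  ∏' n, (1 - Complex.exp (-((a + latticePoint ω n) * l)))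

theorem hasProd_expProd {m : ℕ} {ω : Fin m → ℂ} (hω : ∀ i, 0 < (ω i).re) (a : ℂ)
    {l : ℝ} (hl : 0 < l) :
    HasProd (fun n => 1 - Complex.exp (-((a + latticePoint ω n) * l))) (expProd ω l a) := by
  have := Complex.multipliable_one_add_of_summable
    (summable_norm_cexp_latticePoint hω a hl).of_norm
  simp_rw [← sub_eq_add_neg] at this
  exact this.hasProd

theorem expProd_ne_zero {m : ℕ} {ω : Fin m → ℂ} (hω : ∀ i, 0 < (ω i).re) {a : ℂ}
    {l : ℝ} (hl : 0 < l) (h : ∀ n, 1 - Complex.exp (-((a + latticePoint ω n) * l)) ≠ 0) :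
    expProd ω l a ≠ 0 := by
  have := tprod_one_add_ne_zero_of_summable
    (f := fun n => -Complex.exp (-((a + latticePoint ω n) * l)))
    (fun n => by rw [← sub_eq_add_neg]; exact h n) (summable_norm_cexp_latticePoint hω a hl)
  simpa only [← sub_eq_add_neg] using! this

theorem prod_expProd_zpow {m : ℕ} {ω : Fin m → ℂ} (hω : ∀ i, 0 < (ω i).re)
    {J : Type*} [Fintype J] {a : J → ℂ} {ε : J → ℤ} {l : ℝ} (hl : 0 < l)
    (h : ∀ j, ε j < 0 → ∀ n, 1 - Complex.exp (-((a j + latticePoint ω n) * l)) ≠ 0) :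
    ∏ j, expProd ω l (a j) ^ ε j =
      ∏' n, ∏ j, (1 - Complex.exp (-((a j + latticePoint ω n) * l))) ^ ε j := by
  refine (HasProd.tprod_eq (hasProd_prod fun j _ => ?_)).symm
  have h1 := hasProd_expProd hω (a j) hl
  rw [HasProd] at h1 ⊢
  refine (h1.zpow₀ (ε j) ?_).congr fun s => (Finset.prod_zpow _ _ _).symm
  rcases lt_or_ge (ε j) 0 with h' | h'
  · exact Or.inl (expProd_ne_zero hω hl (h j h'))
  · exact Or.inr h'

/-- Under the scaling limit a balanced product of `q`-products tends to the product of the limits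
of its factors: vanishing moments give a summable bound uniform in the scale. -/
theorem tendsto_prod_expProd {m : ℕ} {ω : Fin m → ℂ} (hω : ∀ i, 0 < (ω i).re)
    {J : Type*} [Fintype J] {a : J → ℂ} {ε : J → ℤ}
    (hε : ∀ k ≤ m, ∑ j, (ε j : ℂ) * a j ^ k = 0)
    (ha : ∀ j, ε j < 0 → ∀ n, a j + latticePoint ω n ≠ 0) :
    Tendsto (fun l : ℝ => ∏ j, expProd ω l (a j) ^ ε j) (𝓝[>] 0)
      (𝓝 (∏' n, ∏ j, (a j + latticePoint ω n) ^ ε j)) := by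
  classical
  have h0 : ∑ j, ε j = 0 := by
    have : ∑ j, (ε j : ℂ) = 0 := by simpa using hε 0 (Nat.zero_le m)
    exact_mod_cast this
  obtain ⟨B, hB⟩ := exists_bound_prod_one_sub_cexp hω hε
  set good : (Fin m → ℕ) → Prop := fun n => (∀ j, 0 < (a j + latticePoint ω n).re) ∧
    ∀ l : ℝ, 0 < l → ‖∏ j, (1 - Complex.exp (-((a j + latticePoint ω n) * l))) ^ ε j - 1‖ ≤
        B * height n ^ (-((m : ℝ) + 1)) with hgood
  have hbad : {n | ¬ good n}.Finite := hB
  have hlim : ∀ n, Tendsto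
      (fun l : ℝ => ∏ j, (1 - Complex.exp (-((a j + latticePoint ω n) * l))) ^ ε j - 1)
      (𝓝[>] 0) (𝓝 (∏ j, (a j + latticePoint ω n) ^ ε j - 1)) := fun n =>
    (tendsto_prod_one_sub_cexp h0 fun j hj => ha j hj n).sub_const 1
  have hlimit := tendsto_tprod_one_add_of_dominated_convergence (𝓕 := 𝓝[>] (0 : ℝ))
    (bound := fun n => if good n then B * height n ^ (-((m : ℝ) + 1))
      else ‖∏ j, (a j + latticePoint ω n) ^ ε j - 1‖ + 1) ?_ hlim ?_
  · simp only [add_sub_cancel] at hlimit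
    refine hlimit.congr' ?_
    -- for small `l` no factor in a denominator vanishes
    have hnz : ∀ᶠ l : ℝ in 𝓝[>] 0, ∀ n ∈ {n | ¬ good n}, ∀ j, ε j < 0 →
        1 - Complex.exp (-((a j + latticePoint ω n) * l)) ≠ 0 := by
      refine (eventually_all_finite hbad).2 fun n _ => eventually_all.2 fun j => ?_
      by_cases hj : ε j < 0
      · filter_upwards [(tendsto_one_sub_cexp_div (a j + latticePoint ω n)).eventually_ne
          (ha j hj n)] with l hl _ h
        rw [h, zero_div] at hl
        exact hl rfl
      · exact Eventually.of_forall fun l h => absurd h hj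
    filter_upwards [hnz, self_mem_nhdsWithin] with l hl hl0
    refine (prod_expProd_zpow hω hl0 fun j hj n => ?_).symm
    by_cases hn : good n
    · exact one_sub_cexp_neg_mul_ne_zero (hn.1 j) hl0
    · exact hl n hn j hj
  · refine ((summable_height_rpow (m := m) (σ := (m : ℝ) + 1) (by linarith)).mul_left
      B).congr_cofinite ?_
    filter_upwards [hB] with n hn
    rw [if_pos hn]
  · have hb : ∀ᶠ l : ℝ in 𝓝[>] 0, ∀ n ∈ {n | ¬ good n},
        ‖∏ j, (1 - Complex.exp (-((a j + latticePoint ω n) * l))) ^ ε j - 1‖ ≤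
          ‖∏ j, (a j + latticePoint ω n) ^ ε j - 1‖ + 1 := by
      refine (eventually_all_finite hbad).2 fun n _ => ?_
      exact (hlim n).norm.eventually_le_const (lt_add_one _)
    filter_upwards [hb, self_mem_nhdsWithin] with l hl hl0 n
    split_ifs with hn
    · exact hn.2 l hl0
    · exact hl n hn

/-! ### Reflection formulas -/

/-- The partial products of `∏ (u + n) (1 - u + n)` in terms of Euler's product for the sine. -/
theorem prod_add_mul_one_sub_add (u : ℂ) (N : ℕ) :
    (∏ n ∈ Finset.range (N + 1), ((u + n) * (1 - u + n))) * Real.pi =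
      (N.factorial : ℂ) ^ 2 * (N + 1 - u) *
        (Real.pi * u * ∏ j ∈ Finset.range N, (1 - u ^ 2 / ((j : ℂ) + 1) ^ 2)) := by
  induction N with
  | zero => simp; ring
  | succ N ih =>
    have hN : (N : ℂ) + 1 ≠ 0 := by exact_mod_cast Nat.succ_ne_zero N
    rw [Finset.prod_range_succ, mul_right_comm, ih, Finset.prod_range_succ _ N, Nat.factorial_succ]
    push_cast
    field_simp
    ring

theorem sin_pi_mul_div_ne_zero {a ω : ℂ} (hω : ω ≠ 0) (h : Complex.sin (Real.pi * a / ω) ≠ 0)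
    (k : ℤ) : a ≠ k * ω := by
  rintro rfl
  refine h (Complex.sin_eq_zero_iff.2 ⟨k, ?_⟩)
  field_simp

theorem exists_eq_of_sin_pi_mul_div_eq_zero {a ω : ℂ} (hω : ω ≠ 0)
    (h : Complex.sin (Real.pi * a / ω) = 0) : ∃ k : ℤ, a = k * ω := by
  obtain ⟨k, hk⟩ := Complex.sin_eq_zero_iff.1 h
  refine ⟨k, ?_⟩
  have hpi : (Real.pi : ℂ) ≠ 0 := Complex.ofReal_ne_zero.2 Real.pi_ne_zero
  field_simp at hk
  linear_combination hk

theorem latticePoint_singleton (ω : ℂ) (n : Fin 1 → ℕ) : latticePoint ![ω] n = n 0 * ω := by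
  simp [latticePoint]

theorem latticePoint_pair (ω₁ ω₂ : ℂ) (n : Fin 2 → ℕ) :
    latticePoint ![ω₁, ω₂] n = n 0 * ω₁ + n 1 * ω₂ := by
  simp [latticePoint, Fin.sum_univ_two]

theorem tendsto_prod_reflection {u v : ℂ} (hv : Complex.sin (Real.pi * v) ≠ 0) :
    Tendsto (fun N : ℕ => ∏ n ∈ Finset.range N,
      ((u + n) * (1 - u + n) / ((v + n) * (1 - v + n)))) atTop
      (𝓝 (Complex.sin (Real.pi * u) / Complex.sin (Real.pi * v))) := by
  rw [← tendsto_add_atTop_iff_nat 1]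
  have h1 : Tendsto (fun N : ℕ => 1 / ((N : ℂ) + 1)) atTop (𝓝 0) :=
    tendsto_one_div_add_atTop_nhds_zero_nat
  have h2 : ∀ w : ℂ, Tendsto (fun N : ℕ => 1 - w * (1 / ((N : ℂ) + 1))) atTop (𝓝 1) := fun w => by
    simpa using (h1.const_mul w).const_sub 1
  have h3 := ((h2 u).div (h2 v) one_ne_zero).mul
    ((Complex.tendsto_euler_sin_prod u).div (Complex.tendsto_euler_sin_prod v) hv)
  rw [div_one, one_mul] at h3
  refine h3.congr fun N => ?_
  have hN : (N : ℂ) + 1 ≠ 0 := by exact_mod_cast Nat.succ_ne_zero N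
  have hpi : (Real.pi : ℂ) ≠ 0 := Complex.ofReal_ne_zero.2 Real.pi_ne_zero
  have hf : (N.factorial : ℂ) ≠ 0 := by exact_mod_cast N.factorial_ne_zero
  have e : ∀ w : ℂ, 1 - w * (1 / ((N : ℂ) + 1)) = (N + 1 - w) / (N + 1) := fun w => by
    field_simp
  rw [Finset.prod_div_distrib, ← mul_div_mul_right _ _ hpi, prod_add_mul_one_sub_add,
    prod_add_mul_one_sub_add]
  simp only [Pi.div_apply]
  rw [e, e, div_div_div_cancel_right₀ hN, div_mul_div_comm, mul_assoc (_ ^ 2) (_ - u),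
    mul_assoc (_ ^ 2) (_ - v), mul_div_mul_left _ _ (pow_ne_zero 2 hf)]

/-- The balanced product `∏ (a + nω) (ω - a + nω) / ((b + nω) (ω - b + nω))` is a quotient of
sines. -/
theorem tprod_reflection {ω : ℂ} (hω : 0 < ω.re) {a b : ℂ}
    (hb : Complex.sin (Real.pi * b / ω) ≠ 0) :
    ∏' n : Fin 1 → ℕ, ∏ j : Fin 4, (![a, ω - a, b, ω - b] j + latticePoint ![ω] n) ^
        (![1, 1, -1, -1] : Fin 4 → ℤ) j =
      Complex.sin (Real.pi * a / ω) / Complex.sin (Real.pi * b / ω) := by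
  have hω0 : ω ≠ 0 := by
    rintro rfl
    simp at hω
  have hterm : ∀ n : Fin 1 → ℕ, ∏ j : Fin 4, (![a, ω - a, b, ω - b] j + latticePoint ![ω] n) ^
        (![1, 1, -1, -1] : Fin 4 → ℤ) j =
      (a / ω + n 0) * (1 - a / ω + n 0) / ((b / ω + n 0) * (1 - b / ω + n 0)) := by
    intro n
    have e1 : ∀ c : ℂ, c + (n 0 : ℂ) * ω = ω * (c / ω + n 0) := fun c => by field_simp
    have e2 : ∀ c : ℂ, (ω - c) / ω = 1 - c / ω := fun c => by field_simp
    simp only [Fin.prod_univ_four, latticePoint_singleton, Matrix.cons_val, e1, e2, zpow_one,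
      zpow_neg]
    rw [mul_mul_mul_comm, mul_assoc, ← mul_inv, mul_mul_mul_comm ω (b / ω + n 0),
      ← div_eq_mul_inv, mul_div_mul_left _ _ (mul_ne_zero hω0 hω0)]
  by_cases ha : Complex.sin (Real.pi * a / ω) = 0
  · rw [ha, zero_div]
    obtain ⟨k, hk⟩ := exists_eq_of_sin_pi_mul_div_eq_zero hω0 ha
    have hk' : a / ω = k := by rw [hk, mul_div_cancel_right₀ _ hω0]
    refine tprod_of_exists_eq_zero ?_
    simp_rw [hterm, hk']
    rcases le_or_gt k 0 with h | h
    · lift -k to ℕ using (by omega) with K hK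
      refine ⟨fun _ => K, ?_⟩
      have : (k : ℂ) + (K : ℂ) = 0 := by
        have : k + (K : ℤ) = 0 := by omega
        exact_mod_cast this
      simp [this]
    · lift k - 1 to ℕ using (by omega) with K hK
      refine ⟨fun _ => K, ?_⟩
      have : 1 - (k : ℂ) + (K : ℂ) = 0 := by
        have : 1 - k + (K : ℤ) = 0 := by omega
        exact_mod_cast this
      simp [this]
  · have hp : HasProd (fun n : Fin 1 → ℕ => ∏ j : Fin 4,
        (![a, ω - a, b, ω - b] j + latticePoint ![ω] n) ^ (![1, 1, -1, -1] : Fin 4 → ℤ) j) _ :=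
      hasProd_multipleGamma (ω := ![ω]) (by simpa using hω) ?_ ?_
    · rw [hp.tprod_eq]
      simp_rw [hterm] at hp
      rw [← (Equiv.funUnique (Fin 1) ℕ).symm.hasProd_iff] at hp
      refine tendsto_nhds_unique hp.tendsto_prod_nat ?_
      have hv : Complex.sin (Real.pi * (b / ω)) ≠ 0 := by rwa [← mul_div_assoc]
      have := tendsto_prod_reflection (u := a / ω) hv
      rw [← mul_div_assoc, ← mul_div_assoc] at this
      exact this
    · intro k hk
      interval_cases k <;> simp [Fin.sum_univ_four]
      ring
    · intro j n h
      rw [latticePoint_singleton] at h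
      fin_cases j
      · exact sin_pi_mul_div_ne_zero hω0 ha (-(n 0 : ℤ)) (by
          push_cast; linear_combination (norm := simp) h)
      · exact sin_pi_mul_div_ne_zero hω0 ha (n 0 + 1 : ℤ) (by
          push_cast; linear_combination (norm := (simp; ring)) -h)
      · exact sin_pi_mul_div_ne_zero hω0 hb (-(n 0 : ℤ)) (by
          push_cast; linear_combination (norm := simp) h)
      · exact sin_pi_mul_div_ne_zero hω0 hb (n 0 + 1 : ℤ) (by
          push_cast; linear_combination (norm := (simp; ring)) -h)

theorem gamma1_reflection {ω : ℂ} (hω : 0 < ω.re) (a : ℂ) {b : ℂ}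
    (hb : Complex.sin (Real.pi * b / ω) ≠ 0) :
    gamma1 b ω * gamma1 (ω - b) ω / (gamma1 a ω * gamma1 (ω - a) ω) =
      Complex.sin (Real.pi * a / ω) / Complex.sin (Real.pi * b / ω) := by
  rw [← tprod_reflection hω hb, ← prod_multipleGamma_eq_tprod (by simpa using hω)]
  · simp only [Fin.prod_univ_four, Matrix.cons_val, gamma1, zpow_one, zpow_neg, inv_inv]
    rw [div_eq_mul_inv, mul_inv]
    ring
  · intro k hk
    interval_cases k <;> simp [Fin.sum_univ_four]
    ring
  · intro j
    fin_cases j <;> simp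

theorem gamma1_ne_zero {ω : ℂ} (hω : 0 < ω.re) {a : ℂ}
    (ha : Complex.sin (Real.pi * a / ω) ≠ 0) : gamma1 a ω ≠ 0 := by
  have hω0 : ω ≠ 0 := by
    rintro rfl
    simp at hω
  refine multipleGamma_ne_zero (by simpa using hω) fun n h => ?_
  rw [latticePoint_singleton] at h
  exact sin_pi_mul_div_ne_zero hω0 ha (-(n 0 : ℤ)) (by push_cast; linear_combination h)

/-! ### The normalization factor -/

theorem gamma2_eq_mul_shift (x : ℂ) {r : ℂ} (hr : 0 < r.re) :
    gamma2 x r 2 = gamma2 (x + r) r 2 * gamma1 x 2 :=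
  multipleGamma_eq_mul_shift (ω := ![r, 2]) x (by simp [Fin.forall_fin_two, hr])

open Complex in
/-- Four applications of the difference equation with period `r` reduce the quotient of the two sides
to a quotient of `Γ₁( · | 2)`, which the reflection formula evaluates. -/
theorem rho_eq_rhoV8 {r : ℂ} (hr : 0 < r.re) {β : ℂ} (hβ : sin (I * β) ≠ 0) :
    rho β r = rhoV8 β r := by
  have hpi : (Real.pi : ℂ) ≠ 0 := ofReal_ne_zero.2 Real.pi_ne_zero
  have e1 : I * β = Real.pi * (I * β / Real.pi) := by field_simp
  have e2 : I * β / 2 = Real.pi * (I * β / Real.pi) / 2 := by field_simp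
  rw [rho, rhoV8, e2]
  rw [e1] at hβ
  generalize I * β / Real.pi = x at hβ ⊢
  have hsc : sin (Real.pi * x / 2) ≠ 0 ∧ cos (Real.pi * x / 2) ≠ 0 := by
    have : sin (Real.pi * x) = 2 * sin (Real.pi * x / 2) * cos (Real.pi * x / 2) := by
      rw [← sin_two_mul]
      congr 1
      ring
    rw [this] at hβ
    exact ⟨fun h => hβ (by rw [h]; ring), fun h => hβ (by rw [h]; ring)⟩
  have hneg : sin (Real.pi * -x / 2) = -sin (Real.pi * x / 2) := by
    rw [← sin_neg]
    congr 1
    ring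
  have hsub : sin (Real.pi * (1 - x) / 2) = cos (Real.pi * x / 2) := by
    rw [← sin_pi_div_two_sub]
    congr 1
    ring
  have hadd : sin (Real.pi * (1 + x) / 2) = cos (Real.pi * x / 2) := by
    rw [← sin_add_pi_div_two]
    congr 1
    ring
  have h2 : (0 : ℝ) < (2 : ℂ).re := by norm_num
  have href := gamma1_reflection h2 (1 - x) (b := -x) (by rw [hneg]; exact neg_ne_zero.2 hsc.1)
  rw [hneg, hsub, div_neg, show (2 : ℂ) - -x = 2 + x by ring,
    show (2 : ℂ) - (1 - x) = 1 + x by ring] at href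
  have g1 : gamma1 (-x) 2 ≠ 0 := gamma1_ne_zero h2 (by rw [hneg]; exact neg_ne_zero.2 hsc.1)
  have g2 : gamma1 (1 - x) 2 ≠ 0 := gamma1_ne_zero h2 (by rw [hsub]; exact hsc.2)
  have g3 : gamma1 (1 + x) 2 ≠ 0 := gamma1_ne_zero h2 (by rw [hadd]; exact hsc.2)
  have hcot : gamma1 (2 + x) 2 * (gamma1 (1 + x) 2)⁻¹ =
      -(gamma1 (1 - x) 2 * (gamma1 (-x) 2)⁻¹ * cot (Real.pi * x / 2)) := by
    rw [cot, ← mul_neg, ← href]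
    field_simp
  simp only [doubleSine]
  rw [show r + 2 - (1 + x) = r + 1 - x by ring, show r + 2 - (2 + x) = r - x by ring,
    show r + 2 - -x = 2 + x + r by ring, show r + 2 - (1 - x) = r + 1 + x by ring,
    gamma2_eq_mul_shift (2 + x) hr, gamma2_eq_mul_shift (-x) hr, gamma2_eq_mul_shift (1 - x) hr]
  have h1 := gamma2_eq_mul_shift (1 + x) hr
  rw [show (1 : ℂ) + x + r = r + 1 + x by ring] at h1
  rw [show -x + r = r - x by ring, show 1 - x + r = r + 1 - x by ring]
  have h1' : (gamma2 (1 + x) r 2)⁻¹ = (gamma2 (r + 1 + x) r 2)⁻¹ * (gamma1 (1 + x) 2)⁻¹ := by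
    rw [h1, mul_inv]
  simp only [div_eq_mul_inv, mul_pow, mul_inv, inv_inv]
  linear_combination (norm := ring_nf)
    gamma2 (r + 1 - x) r 2 ^ 2 * (gamma2 (1 + x) r 2)⁻¹ * gamma2 x r 2 *
      (gamma2 (r + 2 - x) r 2)⁻¹ * (gamma2 (r - x) r 2)⁻¹ * gamma2 (2 + x + r) r 2 *
      (gamma1 (2 + x) 2 * h1' + (gamma2 (r + 1 + x) r 2)⁻¹ * hcot)

/-! ### The dynamical Yang–Baxter equation -/

set_option maxHeartbeats 4000000 in
/-- The dynamical Yang–Baxter equation for matrices of face type, entry by entry. The three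
matrices have entries `Bᵢ, Cᵢ, Dᵢ, Eᵢ` at the unshifted dynamical parameter and
`bᵢ k, cᵢ k, dᵢ k, eᵢ k` at the parameters shifted by the eigenvalues of `h`. -/
theorem faceMatrix_yangBaxter {ρ₁ ρ₂ ρ₃ : ℂ} {b₁ c₁ d₁ e₁ b₂ c₂ d₂ e₂ b₃ c₃ d₃ e₃ : Fin 2 → ℂ}
    {B₁ C₁ D₁ E₁ B₂ C₂ D₂ E₂ B₃ C₃ D₃ E₃ : ℂ}
    (h1 : B₂ * b₃ 0 = B₃ * b₂ 0)
    (h2 : B₂ * c₃ 0 = C₃ * B₁ + B₃ * c₂ 0 * D₁)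
    (h3 : C₂ = C₃ * C₁ + B₃ * c₂ 0 * E₁)
    (h4 : c₁ 0 * D₂ * b₃ 0 + b₁ 0 * d₃ 0 = D₃ * b₂ 0)
    (h5 : c₁ 0 * D₂ * c₃ 0 + b₁ 0 * e₃ 0 = E₃ * B₁ + D₃ * c₂ 0 * D₁)
    (h6 : c₁ 0 * E₂ = E₃ * C₁ + D₃ * c₂ 0 * E₁)
    (h7 : b₁ 1 * B₂ = b₂ 1 * B₁)
    (h8 : c₁ 1 * b₃ 1 + b₁ 1 * C₂ * d₃ 1 = b₂ 1 * C₁)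
    (h9 : c₁ 1 * c₃ 1 + b₁ 1 * C₂ * e₃ 1 = c₂ 1)
    (h10 : e₁ 0 * D₂ * b₃ 0 + d₁ 0 * d₃ 0 = d₂ 0)
    (h11 : e₁ 0 * D₂ * c₃ 0 + d₁ 0 * e₃ 0 = e₂ 0 * D₁)
    (h12 : e₁ 0 * E₂ = e₂ 0 * E₁)
    (h13 : d₁ 1 * B₂ = C₃ * d₂ 1 * B₁ + B₃ * D₁)
    (h14 : e₁ 1 * b₃ 1 + d₁ 1 * C₂ * d₃ 1 = C₃ * d₂ 1 * C₁ + B₃ * E₁)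
    (h15 : e₁ 1 * c₃ 1 + d₁ 1 * C₂ * e₃ 1 = C₃ * e₂ 1)
    (h16 : D₂ = E₃ * d₂ 1 * B₁ + D₃ * D₁)
    (h17 : E₂ * d₃ 1 = E₃ * d₂ 1 * C₁ + D₃ * E₁)
    (h18 : E₂ * e₃ 1 = E₃ * e₂ 1) :
    emb12 (fun k => faceMatrix ρ₁ (b₁ k) (c₁ k) (d₁ k) (e₁ k)) *
        emb13 (fun _ => faceMatrix ρ₂ B₂ C₂ D₂ E₂) *
        emb23 (fun k => faceMatrix ρ₃ (b₃ k) (c₃ k) (d₃ k) (e₃ k)) =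
      emb23 (fun _ => faceMatrix ρ₃ B₃ C₃ D₃ E₃) *
        emb13 (fun k => faceMatrix ρ₂ (b₂ k) (c₂ k) (d₂ k) (e₂ k)) *
        emb12 (fun _ => faceMatrix ρ₁ B₁ C₁ D₁ E₁) := by
  have f00 : finProdFinEquiv ((0 : Fin 2), (0 : Fin 2)) = (0 : Fin 4) := rfl
  have f01 : finProdFinEquiv ((0 : Fin 2), (1 : Fin 2)) = (1 : Fin 4) := rfl
  have f10 : finProdFinEquiv ((1 : Fin 2), (0 : Fin 2)) = (2 : Fin 4) := rfl
  have f11 : finProdFinEquiv ((1 : Fin 2), (1 : Fin 2)) = (3 : Fin 4) := rfl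
  ext ⟨i1, i2, i3⟩ ⟨j1, j2, j3⟩
  -- of the 64 entries, the 20 which preserve the weight are not trivially zero
  fin_cases i1 <;> fin_cases i2 <;> fin_cases i3 <;> fin_cases j1 <;> fin_cases j2 <;>
    fin_cases j3 <;>
    simp [Matrix.mul_apply, Fintype.sum_prod_type, Fin.sum_univ_two, emb12, emb13, emb23,
      faceMatrix, -mul_eq_mul_left_iff, -mul_eq_mul_right_iff, f00, f01, f10, f11]
  · ring
  · linear_combination (ρ₁ * ρ₂ * ρ₃) * h1
  · linear_combination (ρ₁ * ρ₂ * ρ₃) * h2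
  · linear_combination (ρ₁ * ρ₂ * ρ₃) * h3
  · linear_combination (ρ₁ * ρ₂ * ρ₃) * h4
  · linear_combination (ρ₁ * ρ₂ * ρ₃) * h5
  · linear_combination (ρ₁ * ρ₂ * ρ₃) * h6
  · linear_combination (ρ₁ * ρ₂ * ρ₃) * h7
  · linear_combination (ρ₁ * ρ₂ * ρ₃) * h8
  · linear_combination (ρ₁ * ρ₂ * ρ₃) * h9
  · linear_combination (ρ₁ * ρ₂ * ρ₃) * h10
  · linear_combination (ρ₁ * ρ₂ * ρ₃) * h11
  · linear_combination (ρ₁ * ρ₂ * ρ₃) * h12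
  · linear_combination (ρ₁ * ρ₂ * ρ₃) * h13
  · linear_combination (ρ₁ * ρ₂ * ρ₃) * h14
  · linear_combination (ρ₁ * ρ₂ * ρ₃) * h15
  · linear_combination (ρ₁ * ρ₂ * ρ₃) * h16
  · linear_combination (ρ₁ * ρ₂ * ρ₃) * h17
  · linear_combination (ρ₁ * ρ₂ * ρ₃) * h18
  · ring

/-- The face matrix with spectral parameter `ξ`, dynamical parameter `σ` and step `η` in the
multiplicative variables `u = e^{2iξ}`, `v = e^{2iσ}`, `H = e^{iη}`; its diagonal entries are
`sin ξ / sin (η + ξ)` times the gauge factors `g` and `g'`. -/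
def trigFace (ρ H u v g g' : ℂ) : Matrix (Fin 2 × Fin 2) (Fin 2 × Fin 2) ℂ :=
  faceMatrix ρ (g * ((u - 1) * H / (H ^ 2 * u - 1)))
    ((v * u - 1) * (H ^ 2 - 1) / ((v - 1) * (H ^ 2 * u - 1)))
    ((v - u) * (H ^ 2 - 1) / ((v - 1) * (H ^ 2 * u - 1)))
    (g' * ((u - 1) * H / (H ^ 2 * u - 1)))

/-- Only the products `g * g'` of the gauge factors enter the dynamical Yang–Baxter equation. -/
theorem trigFace_yangBaxter {ρ₁ ρ₂ ρ₃ H x y w : ℂ} {v g g' : Fin 2 → ℂ} {G G' : ℂ}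
    (hH : H ≠ 0) (hx : H ^ 2 * x - 1 ≠ 0) (hy : H ^ 2 * y - 1 ≠ 0)
    (hxy : H ^ 2 * (x * y) - 1 ≠ 0) (hw : w - 1 ≠ 0) (hwp : w * H ^ 2 - 1 ≠ 0)
    (hwm : w - H ^ 2 ≠ 0) (hv0 : v 0 = w * H ^ 2) (hv1 : v 1 = w / H ^ 2)
    (hG : G * G' = (w * H ^ 2 - 1) * (w - H ^ 2) / (H ^ 2 * (w - 1) ^ 2))
    (hg : ∀ k, g k * g' k = (v k * H ^ 2 - 1) * (v k - H ^ 2) / (H ^ 2 * (v k - 1) ^ 2)) :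
    emb12 (fun k => trigFace ρ₁ H x (v k) (g k) (g' k)) *
        emb13 (fun _ => trigFace ρ₂ H (x * y) w G G') *
        emb23 (fun k => trigFace ρ₃ H y (v k) (g k) (g' k)) =
      emb23 (fun _ => trigFace ρ₃ H y w G G') *
        emb13 (fun k => trigFace ρ₂ H (x * y) (v k) (g k) (g' k)) *
        emb12 (fun _ => trigFace ρ₁ H x w G G') := by
  have hg0 := hg 0
  have hg1 := hg 1
  have hwm' : w / H ^ 2 - 1 ≠ 0 := by
    rw [div_sub_one (pow_ne_zero 2 hH)]
    exact div_ne_zero hwm (pow_ne_zero 2 hH)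
  -- the denominators in the forms in which `field_simp` meets them
  have hx' : x * H ^ 2 - 1 ≠ 0 := by rwa [mul_comm]
  have hy' : y * H ^ 2 - 1 ≠ 0 := by rwa [mul_comm]
  have hwp' : H ^ 2 * w - 1 ≠ 0 := by rwa [mul_comm]
  have hxy1 : H ^ 2 * x * y - 1 ≠ 0 := by rwa [mul_assoc]
  have hxy2 : x * H ^ 2 * y - 1 ≠ 0 := by rwa [mul_comm x]
  have hxy3 : x * y * H ^ 2 - 1 ≠ 0 := by rwa [mul_comm]
  have hxy4 : y * x * H ^ 2 - 1 ≠ 0 := by rwa [mul_comm y]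
  have hxy5 : y * H ^ 2 * x - 1 ≠ 0 := by rwa [mul_assoc, mul_comm]
  have hxy6 : H ^ 2 * y * x - 1 ≠ 0 := by rwa [mul_assoc, mul_comm y]
  rw [hv0] at hg0
  rw [hv1] at hg1
  unfold trigFace
  apply faceMatrix_yangBaxter <;> try simp only [hv0, hv1]
  · ring
  · field_simp
    ring
  · linear_combination (norm := skip)
      (-(((y - 1) * H / (H ^ 2 * (y) - 1)) * (((w * H ^ 2) * (x * y) - 1) * (H ^ 2 - 1) / ((w * H ^ 2 - 1) * (H ^ 2 * (x * y) - 1))) * ((x - 1) * H / (H ^ 2 * (x) - 1)))) * hG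
    field_simp
    ring
  · field_simp
    ring
  · linear_combination (norm := skip)
      (((x - 1) * H / (H ^ 2 * (x) - 1)) * ((y - 1) * H / (H ^ 2 * (y) - 1))) * hg0 - (((x - 1) * H / (H ^ 2 * (x) - 1)) * ((y - 1) * H / (H ^ 2 * (y) - 1))) * hG
    field_simp
    ring
  · field_simp
    ring
  · ring
  · field_simp
    ring
  · linear_combination (norm := skip)
      (((x - 1) * H / (H ^ 2 * (x) - 1)) * (((w) * (x * y) - 1) * (H ^ 2 - 1) / ((w - 1) * (H ^ 2 * (x * y) - 1))) * ((y - 1) * H / (H ^ 2 * (y) - 1))) * hg1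
    field_simp
    ring
  · linear_combination (norm := skip)
      (((x - 1) * H / (H ^ 2 * (x) - 1)) * (((w) - (x * y)) * (H ^ 2 - 1) / ((w - 1) * (H ^ 2 * (x * y) - 1))) * ((y - 1) * H / (H ^ 2 * (y) - 1))) * hg0
    field_simp
    ring
  · field_simp
    ring
  · ring
  · field_simp
    ring
  · linear_combination (norm := skip)
      (((x - 1) * H / (H ^ 2 * (x) - 1)) * ((y - 1) * H / (H ^ 2 * (y) - 1))) * hg1 - (((x - 1) * H / (H ^ 2 * (x) - 1)) * ((y - 1) * H / (H ^ 2 * (y) - 1))) * hG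
    field_simp
    ring
  · field_simp
    ring
  · linear_combination (norm := skip)
      (-(((y - 1) * H / (H ^ 2 * (y) - 1)) * (((w / H ^ 2) - (x * y)) * (H ^ 2 - 1) / ((w / H ^ 2 - 1) * (H ^ 2 * (x * y) - 1))) * ((x - 1) * H / (H ^ 2 * (x) - 1)))) * hG
    field_simp
    ring
  · field_simp
    ring
  · ring

theorem sin_eq_cexp (z : ℂ) : Complex.sin z =
    -(Complex.I / 2) * (Complex.exp (Complex.I * z))⁻¹ * (Complex.exp (Complex.I * z) ^ 2 - 1) := by
  have h : Complex.exp (Complex.I * z) ≠ 0 := Complex.exp_ne_zero _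
  have e1 : Complex.exp (z * Complex.I) = Complex.exp (Complex.I * z) := by rw [mul_comm]
  have e2 : Complex.exp (-z * Complex.I) = (Complex.exp (Complex.I * z))⁻¹ := by
    rw [← Complex.exp_neg]
    congr 1
    ring
  rw [Complex.sin, e1, e2]
  field_simp
  ring

theorem cexp_sq_sub_one_ne_zero {z : ℂ} (h : Complex.sin z ≠ 0) :
    Complex.exp (Complex.I * z) ^ 2 - 1 ≠ 0 := by
  intro h0
  rw [sin_eq_cexp, h0, mul_zero] at h
  exact h rfl

/-- The gauge factor `Γ₁(s)² / (Γ₁(s + 1) Γ₁(s - 1))`. -/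
def gammaGauge (r s : ℂ) : ℂ := gamma1 s r ^ 2 / (gamma1 (s + 1) r * gamma1 (s - 1) r)

/-- The product of the gauge factors of the two diagonal entries is trigonometric. -/
theorem gammaGauge_mul {r s : ℂ} (hr : 0 < r.re) (hs : Complex.sin (Real.pi * s / r) ≠ 0) :
    gammaGauge r (r - s) * gammaGauge r s =
      Complex.sin (Real.pi * (s + 1) / r) * Complex.sin (Real.pi * (s - 1) / r) /
        Complex.sin (Real.pi * s / r) ^ 2 := by
  have h1 := gamma1_reflection hr (s + 1) hs
  have h2 := gamma1_reflection hr (s - 1) hs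
  rw [show r - (s + 1) = r - s - 1 by ring] at h1
  rw [show r - (s - 1) = r - s + 1 by ring] at h2
  rw [pow_two (Complex.sin _), ← div_mul_div_comm, ← h1, ← h2, gammaGauge, gammaGauge]
  simp only [div_eq_mul_inv, mul_inv]
  ring

open Complex in
theorem dynR_eq_trigFace {β r s : ℂ} (hβ : sin ((Real.pi + I * β) / r) ≠ 0)
    (hs : sin (Real.pi * s / r) ≠ 0) :
    dynR β r s = trigFace (rho β r) (exp (I * (Real.pi / r))) (exp (I * (I * β / r)) ^ 2)
      (exp (I * (Real.pi * s / r)) ^ 2) (gammaGauge r (r - s)) (gammaGauge r s) := by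
  have e1 : (Real.pi + I * β) / r = Real.pi / r + I * β / r := add_div _ _ _
  have e2 : (Real.pi * s + I * β) / r = Real.pi * s / r + I * β / r := add_div _ _ _
  have e3 : (Real.pi * s - I * β) / r = Real.pi * s / r - I * β / r := sub_div _ _ _
  have n1 := cexp_sq_sub_one_ne_zero hβ
  have n2 := cexp_sq_sub_one_ne_zero hs
  rw [e1, mul_add, exp_add] at n1
  have hH : exp (I * (Real.pi / r)) ≠ 0 := exp_ne_zero _
  have hX : exp (I * (I * β / r)) ≠ 0 := exp_ne_zero _
  have hW : exp (I * (Real.pi * s / r)) ≠ 0 := exp_ne_zero _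
  rw [dynR, trigFace, gammaGauge, gammaGauge, e1, e2, e3, sin_eq_cexp (I * β / r),
    sin_eq_cexp (Real.pi / r + I * β / r), sin_eq_cexp (Real.pi * s / r + I * β / r),
    sin_eq_cexp (Real.pi * s / r - I * β / r), sin_eq_cexp (Real.pi * s / r),
    sin_eq_cexp (Real.pi / r), mul_add I, mul_add I, mul_sub I, exp_add, exp_add, exp_sub]
  generalize exp (I * (Real.pi / r)) = H at *
  generalize exp (I * (I * β / r)) = X at *
  generalize exp (I * (Real.pi * s / r)) = W at *
  rw [mul_pow] at n1
  have hI : (I : ℂ) ≠ 0 := I_ne_zero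
  congr 1
  · congr 1
    field_simp
  · field_simp
  · field_simp
  · congr 1
    field_simp

open Complex in
theorem dynYangBaxter_dynR {r : ℂ} (hr : 0 < r.re) {β β' s : ℂ}
    (hβ : sin ((Real.pi + I * β) / r) ≠ 0) (hβ' : sin ((Real.pi + I * β') / r) ≠ 0)
    (hββ' : sin ((Real.pi + I * (β + β')) / r) ≠ 0) (hs : sin (Real.pi * s / r) ≠ 0)
    (hsp : sin (Real.pi * (s + 1) / r) ≠ 0) (hsm : sin (Real.pi * (s - 1) / r) ≠ 0) :
    DynYangBaxter (fun β s => dynR β r s) β β' s := by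
  have hsk : ∀ k, sin (Real.pi * (s + hEig k) / r) ≠ 0 := by
    intro k
    fin_cases k
    · simpa [hEig] using hsp
    · simpa [hEig, ← sub_eq_add_neg] using hsm
  have hH : exp (I * (Real.pi / r)) ≠ 0 := exp_ne_zero _
  have hden : ∀ {γ : ℂ}, sin ((Real.pi + I * γ) / r) ≠ 0 →
      exp (I * (Real.pi / r)) ^ 2 * exp (I * (I * γ / r)) ^ 2 - 1 ≠ 0 := by
    intro γ hγ
    have := cexp_sq_sub_one_ne_zero hγ
    rwa [add_div, mul_add, exp_add, mul_pow] at this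
  have hsum : exp (I * (I * (β + β') / r)) ^ 2 =
      exp (I * (I * β / r)) ^ 2 * exp (I * (I * β' / r)) ^ 2 := by
    rw [← mul_pow, ← exp_add]
    congr 2
    ring
  have ep : ∀ z : ℂ, exp (I * (Real.pi * (z + 1) / r)) =
      exp (I * (Real.pi * z / r)) * exp (I * (Real.pi / r)) := by
    intro z
    rw [← exp_add]
    congr 1
    ring
  have em : ∀ z : ℂ, exp (I * (Real.pi * (z - 1) / r)) =
      exp (I * (Real.pi * z / r)) / exp (I * (Real.pi / r)) := by
    intro z
    rw [← exp_sub]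
    congr 1
    ring
  have hgauge : ∀ z : ℂ, sin (Real.pi * z / r) ≠ 0 →
      gammaGauge r (r - z) * gammaGauge r z =
        (exp (I * (Real.pi * z / r)) ^ 2 * exp (I * (Real.pi / r)) ^ 2 - 1) *
          (exp (I * (Real.pi * z / r)) ^ 2 - exp (I * (Real.pi / r)) ^ 2) /
          (exp (I * (Real.pi / r)) ^ 2 * (exp (I * (Real.pi * z / r)) ^ 2 - 1) ^ 2) := by
    intro z hz
    have n := cexp_sq_sub_one_ne_zero hz
    rw [gammaGauge_mul hr hz, sin_eq_cexp (Real.pi * (z + 1) / r),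
      sin_eq_cexp (Real.pi * (z - 1) / r), sin_eq_cexp (Real.pi * z / r), ep, em]
    have hW : exp (I * (Real.pi * z / r)) ≠ 0 := exp_ne_zero _
    have hI : (I : ℂ) ≠ 0 := I_ne_zero
    field_simp
  unfold DynYangBaxter
  simp only [dynR_eq_trigFace hβ hs, dynR_eq_trigFace hββ' hs, dynR_eq_trigFace hβ' hs,
    dynR_eq_trigFace hβ (hsk _), dynR_eq_trigFace hββ' (hsk _), dynR_eq_trigFace hβ' (hsk _), hsum]
  refine trigFace_yangBaxter (v := fun k => exp (I * (Real.pi * (s + hEig k) / r)) ^ 2)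
    (g := fun k => gammaGauge r (r - (s + hEig k))) (g' := fun k => gammaGauge r (s + hEig k))
    hH (hden hβ) (hden hβ') ?_ (cexp_sq_sub_one_ne_zero hs) ?_ ?_ ?_ ?_ (hgauge s hs)
    fun k => hgauge _ (hsk k)
  · rw [← hsum]
    exact hden hββ'
  · have := cexp_sq_sub_one_ne_zero hsp
    rwa [ep, mul_pow] at this
  · have := cexp_sq_sub_one_ne_zero hsm
    rw [em, div_pow, div_sub_one (pow_ne_zero 2 hH)] at this
    exact (div_ne_zero_iff.1 this).1
  · change exp (I * (Real.pi * (s + 1) / r)) ^ 2 = _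
    rw [ep, mul_pow]
  · change exp (I * (Real.pi * (s + -1) / r)) ^ 2 = _
    rw [← sub_eq_add_neg, em, div_pow]

/-! ### The scaling limit of the elliptic `R`-matrix -/

theorem qProd_cexp {m : ℕ} (ω : Fin m → ℂ) (l : ℝ) (a : ℂ) :
    qProd (Complex.exp (-(a * l))) (fun i => Complex.exp (-(ω i * l))) = expProd ω l a := by
  unfold qProd expProd
  refine tprod_congr fun n => ?_
  rw [← cexp_latticePoint, ← Complex.exp_add]
  congr 2
  ring

theorem qProd_cexp_one (r : ℂ) (l : ℝ) (a : ℂ) :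
    qProd (Complex.exp (-(a * l))) ![Complex.exp (-(r * l))] = expProd ![r] l a := by
  rw [← qProd_cexp]
  congr 1
  ext i
  fin_cases i
  rfl

theorem qProd_cexp_two (r : ℂ) (l : ℝ) (a : ℂ) :
    qProd (Complex.exp (-(a * l))) ![Complex.exp (-(r * l)), Complex.exp (-(2 * l))] =
      expProd ![r, 2] l a := by
  rw [← qProd_cexp]
  congr 1
  ext i
  fin_cases i <;> rfl

/-- The theta function `Θ_p(z)` at `p = e^{-rl}`, `z = e^{-al}`. -/
def expTheta (r : ℂ) (l : ℝ) (a : ℂ) : ℂ :=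
  expProd ![r] l a * expProd ![r] l (r - a) * expProd ![r] l r

theorem theta_cexp (r : ℂ) (l : ℝ) (a : ℂ) :
    theta (Complex.exp (-(r * l))) (Complex.exp (-(a * l))) = expTheta r l a := by
  have : Complex.exp (-(r * l)) * (Complex.exp (-(a * l)))⁻¹ = Complex.exp (-((r - a) * l)) := by
    rw [← Complex.exp_neg, ← Complex.exp_add]
    congr 1
    ring
  rw [theta, this, qProd_cexp_one, qProd_cexp_one, qProd_cexp_one, expTheta]

/-- The elliptic `R`-matrix in additive notation, `p = e^{-rl}`, `z = e^{-xl}`, `w = e^{-sl}`. The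
factors of the entries are ordered as those of `dynR`. -/
theorem ellipticR_cexp (q x r s : ℂ) (l : ℝ) (h2 : q ^ 2 = Complex.exp (-(1 * l))) :
    ellipticR q (Complex.exp (-(x * l))) (Complex.exp (-(r * l))) (Complex.exp (-(s * l))) =
      faceMatrix
        (q ^ (-(1 / 2) : ℂ) *
          (expProd ![r, 2] l (1 + x) ^ 2 / (expProd ![r, 2] l x * expProd ![r, 2] l (2 + x)) *
          (expProd ![r, 2] l (r - x) * expProd ![r, 2] l (r + 2 - x) /
            expProd ![r, 2] l (r + 1 - x) ^ 2)))
        (q * (expProd ![r] l (r - s + 1) * expProd ![r] l (r - s - 1) /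
          expProd ![r] l (r - s) ^ 2) * (expTheta r l x / expTheta r l (1 + x)))
        (expTheta r l (s + x) / expTheta r l s * (expTheta r l 1 / expTheta r l (1 + x)))
        (Complex.exp (-(x * l)) * (expTheta r l (r - s + x) / expTheta r l (r - s) *
          (expTheta r l 1 / expTheta r l (1 + x))))
        (q * (expProd ![r] l (s + 1) * expProd ![r] l (s - 1) / expProd ![r] l s ^ 2) *
          (expTheta r l x / expTheta r l (1 + x))) := by
  have hmul : ∀ a b : ℂ, Complex.exp (-(a * l)) * Complex.exp (-(b * l)) =
      Complex.exp (-((a + b) * l)) := fun a b => by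
    rw [← Complex.exp_add]
    congr 1
    ring
  have hinv : ∀ a : ℂ, (Complex.exp (-(a * l)))⁻¹ = Complex.exp (-(-a * l)) := fun a => by
    rw [← Complex.exp_neg]
    congr 1
    ring
  have h4 : q ^ 4 = Complex.exp (-(2 * l)) := by
    rw [show q ^ 4 = q ^ 2 * q ^ 2 by ring, h2, hmul]
    norm_num
  rw [ellipticR, ellipticRho, h4, h2]
  simp only [hinv, hmul, qProd_cexp_one, qProd_cexp_two, theta_cexp]
  rw [show r + -s + 1 = r - s + 1 by ring, show r + -s + -1 = r - s - 1 by ring,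
    show r + -s + x = r - s + x by ring, show r + -s = r - s by ring,
    show r + 2 + -x = r + 2 - x by ring, show r + 1 + -x = r + 1 - x by ring,
    show r + -x = r - x by ring, show s + -1 = s - 1 by ring]
  congr 1
  · ring
  · ring
  · ring

theorem tendsto_expTheta_div {r : ℂ} (hr : 0 < r.re) (a : ℂ) {b : ℂ}
    (hb : Complex.sin (Real.pi * b / r) ≠ 0) :
    Tendsto (fun l : ℝ => expTheta r l a / expTheta r l b) (𝓝[>] 0)
      (𝓝 (Complex.sin (Real.pi * a / r) / Complex.sin (Real.pi * b / r))) := by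
  have hr0 : r ≠ 0 := by
    rintro rfl
    simp at hr
  have hω : ∀ i, 0 < (![r] i).re := by simpa using hr
  have h := tendsto_prod_expProd hω (a := ![a, r - a, b, r - b]) (ε := ![1, 1, -1, -1]) ?_ ?_
  · rw [tprod_reflection hr hb] at h
    refine h.congr' ?_
    filter_upwards [self_mem_nhdsWithin] with l hl
    have hp : expProd ![r] l r ≠ 0 := by
      refine expProd_ne_zero hω hl fun n => one_sub_cexp_neg_mul_ne_zero ?_ hl
      rw [latticePoint_singleton, Complex.add_re, ← Complex.ofReal_natCast, Complex.re_ofReal_mul]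
      positivity
    rw [expTheta, expTheta, mul_div_mul_right _ _ hp]
    simp only [Fin.prod_univ_four, Matrix.cons_val, zpow_one, zpow_neg]
    rw [div_eq_mul_inv, mul_inv]
    ring
  · intro k hk
    interval_cases k <;> simp [Fin.sum_univ_four]
    ring
  · intro j hj n h
    rw [latticePoint_singleton] at h
    fin_cases j
    · simp at hj
    · simp at hj
    · exact sin_pi_mul_div_ne_zero hr0 hb (-(n 0 : ℤ)) (by
        push_cast; linear_combination (norm := simp) h)
    · exact sin_pi_mul_div_ne_zero hr0 hb (n 0 + 1 : ℤ) (by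
        push_cast; linear_combination (norm := (simp; ring)) -h)

theorem tendsto_expProd_gauge {r : ℂ} (hr : 0 < r.re) {c : ℂ}
    (hc : ∀ n : ℕ, c + n * r ≠ 0) :
    Tendsto (fun l : ℝ => expProd ![r] l (c + 1) * expProd ![r] l (c - 1) / expProd ![r] l c ^ 2)
      (𝓝[>] 0) (𝓝 (gamma1 c r ^ 2 / (gamma1 (c + 1) r * gamma1 (c - 1) r))) := by
  have hω : ∀ i, 0 < (![r] i).re := by simpa using hr
  have hmom : ∀ k ≤ 1, ∑ j : Fin 3, ((![1, 1, -2] : Fin 3 → ℤ) j : ℂ) *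
      ![c + 1, c - 1, c] j ^ k = 0 := by
    intro k hk
    interval_cases k <;> simp [Fin.sum_univ_three] <;> ring
  have h := tendsto_prod_expProd hω hmom ?_
  · rw [← prod_multipleGamma_eq_tprod hω hmom (by intro j; fin_cases j <;> simp)] at h
    simp only [Fin.prod_univ_three, Matrix.cons_val, zpow_one, zpow_neg, inv_inv] at h
    convert! h using 2
    rw [gamma1, gamma1, gamma1, div_eq_mul_inv, mul_inv, mul_comm]
    norm_cast
  · intro j hj n
    rw [latticePoint_singleton]
    fin_cases j
    · simp at hj
    · simp at hj
    · exact hc (n 0)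

theorem tendsto_expProd_rho {r : ℂ} (hr : 0 < r.re) {β : ℂ}
    (h1 : ∀ m n : ℕ, Complex.I * β / Real.pi + m * r + n * 2 ≠ 0)
    (h2 : ∀ m n : ℕ, r + 1 - Complex.I * β / Real.pi + m * r + n * 2 ≠ 0) :
    Tendsto (fun l : ℝ =>
      expProd ![r, 2] l (1 + Complex.I * β / Real.pi) ^ 2 /
        (expProd ![r, 2] l (Complex.I * β / Real.pi) *
          expProd ![r, 2] l (2 + Complex.I * β / Real.pi)) *
        (expProd ![r, 2] l (r - Complex.I * β / Real.pi) *
          expProd ![r, 2] l (r + 2 - Complex.I * β / Real.pi) /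
            expProd ![r, 2] l (r + 1 - Complex.I * β / Real.pi) ^ 2))
      (𝓝[>] 0) (𝓝 (rho β r)) := by
  unfold rho
  generalize Complex.I * β / Real.pi = x at h1 h2 ⊢
  have hω : ∀ i, 0 < (![r, 2] i).re := by simp [Fin.forall_fin_two, hr]
  have hmom : ∀ k ≤ 2, ∑ j : Fin 6, ((![2, -1, -1, 1, 1, -2] : Fin 6 → ℤ) j : ℂ) *
      ![1 + x, x, 2 + x, r - x, r + 2 - x, r + 1 - x] j ^ k = 0 := by
    intro k hk
    interval_cases k <;> simp [Fin.sum_univ_six] <;> ring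
  have h := tendsto_prod_expProd hω hmom ?_
  · rw [← prod_multipleGamma_eq_tprod hω hmom (by intro j; fin_cases j <;> simp)] at h
    simp only [Fin.prod_univ_six, Matrix.cons_val, zpow_one, zpow_neg, inv_inv] at h
    convert! h using 2
    · simp only [div_eq_mul_inv, mul_inv]
      norm_cast
      ring
    · simp only [doubleSine, gamma2]
      rw [show r + 2 - (1 + x) = r + 1 - x by ring, show r + 2 - (2 + x) = r - x by ring]
      simp only [div_eq_mul_inv, mul_inv, mul_pow, inv_inv]
      norm_cast
      rw [inv_pow]
      ring
  · intro j hj n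
    rw [latticePoint_pair]
    fin_cases j
    · simp at hj
    · exact fun h => h1 (n 0) (n 1) (by linear_combination (norm := (simp; ring)) h)
    · exact fun h => h1 (n 0) (n 1 + 1) (by
        push_cast; linear_combination (norm := (simp; ring)) h)
    · simp at hj
    · simp at hj
    · exact fun h => h2 (n 0) (n 1) (by linear_combination (norm := (simp; ring)) h)

theorem tendsto_faceMatrix {α : Type*} {F : Filter α} {ρ b c c' b' : α → ℂ}
    {ρ₀ b₀ c₀ c₀' b₀' : ℂ} (hρ : Tendsto ρ F (𝓝 ρ₀)) (hb : Tendsto b F (𝓝 b₀))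
    (hc : Tendsto c F (𝓝 c₀)) (hc' : Tendsto c' F (𝓝 c₀')) (hb' : Tendsto b' F (𝓝 b₀')) :
    Tendsto (fun t => faceMatrix (ρ t) (b t) (c t) (c' t) (b' t)) F
      (𝓝 (faceMatrix ρ₀ b₀ c₀ c₀' b₀')) := by
  refine tendsto_pi_nhds.2 fun i => tendsto_pi_nhds.2 fun j => ?_
  simp only [faceMatrix, Matrix.smul_apply, Matrix.submatrix_apply, smul_eq_mul]
  refine hρ.mul ?_
  generalize finProdFinEquiv i = i'
  generalize finProdFinEquiv j = j'
  fin_cases i' <;> fin_cases j' <;> first | exact tendsto_const_nhds | assumption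

open Complex in
theorem tendsto_ellipticR {r : ℂ} (hr : 0 < r.re) {β s : ℂ}
    (hβ : sin ((Real.pi + I * β) / r) ≠ 0) (hs : sin (Real.pi * s / r) ≠ 0)
    (h1 : ∀ m n : ℕ, I * β / Real.pi + m * r + n * 2 ≠ 0)
    (h2 : ∀ m n : ℕ, r + 1 - I * β / Real.pi + m * r + n * 2 ≠ 0) :
    Tendsto
      (fun q : ℝ => ellipticR (q : ℂ) ((q : ℂ) ^ (2 * I * β / Real.pi))
        ((q : ℂ) ^ (2 * r)) ((q : ℂ) ^ (2 * s)))
      (𝓝[<] 1) (𝓝 (dynR β r s)) := by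
  have hr0 : r ≠ 0 := by
    rintro rfl
    simp at hr
  have hpi : (Real.pi : ℂ) ≠ 0 := ofReal_ne_zero.2 Real.pi_ne_zero
  -- the scale `l = -2 log q`, for which `q ^ (2 * a) = e^{-al}`
  have hl : Tendsto (fun q : ℝ => -2 * Real.log q) (𝓝[<] 1) (𝓝[>] 0) := by
    refine tendsto_nhdsWithin_iff.2 ⟨?_, ?_⟩
    · have := (Real.continuousAt_log one_ne_zero).tendsto.const_mul (-2)
      rw [Real.log_one, mul_zero] at this
      exact this.mono_left nhdsWithin_le_nhds
    · filter_upwards [Ioo_mem_nhdsLT (zero_lt_one (α := ℝ))] with q hq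
      have := Real.log_neg hq.1 hq.2
      simp only [Set.mem_Ioi]
      linarith
  have hpow : ∀ c : ℂ, Tendsto (fun q : ℝ => (q : ℂ) ^ c) (𝓝[<] 1) (𝓝 1) := by
    intro c
    have := (continuousAt_ofReal_cpow_const 1 c (Or.inr one_ne_zero)).tendsto
    rw [ofReal_one, one_cpow] at this
    exact this.mono_left nhdsWithin_le_nhds
  have hq1 : Tendsto (fun q : ℝ => (q : ℂ)) (𝓝[<] 1) (𝓝 1) := by simpa using hpow 1
  have hscale : ∀ q : ℝ, 0 < q → ∀ a : ℂ,
      (q : ℂ) ^ (2 * a) = exp (-(a * ((-2 * Real.log q : ℝ) : ℂ))) := by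
    intro q hq a
    rw [cpow_def_of_ne_zero (ofReal_ne_zero.2 hq.ne'), ← ofReal_log hq.le]
    congr 1
    push_cast
    ring
  set x : ℂ := I * β / Real.pi with hx
  have exr : ∀ a : ℂ, Real.pi * (a + x) / r = (Real.pi * a + I * β) / r := fun a => by
    rw [hx]; field_simp
  have es1 : Real.pi * (r - s + x) / r = Real.pi - (Real.pi * s - I * β) / r := by
    rw [hx]; field_simp; ring
  have es2 : Real.pi * (r - s) / r = Real.pi - Real.pi * s / r := by
    field_simp
  have hb : sin (Real.pi * (1 + x) / r) ≠ 0 := by rwa [exr, mul_one]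
  have hrs : sin (Real.pi * (r - s) / r) ≠ 0 := by rwa [es2, sin_pi_sub]
  have hgauge : ∀ c : ℂ, sin (Real.pi * c / r) ≠ 0 → ∀ n : ℕ, c + n * r ≠ 0 := fun c hc n h =>
    sin_pi_mul_div_ne_zero hr0 hc (-(n : ℤ)) (by push_cast; linear_combination h)
  have t1 := (tendsto_expTheta_div hr x hb).comp hl
  have t2 := (tendsto_expTheta_div hr 1 hb).comp hl
  have t3 := (tendsto_expTheta_div hr (s + x) hs).comp hl
  have t4 := (tendsto_expTheta_div hr (r - s + x) hrs).comp hl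
  have t5 := (tendsto_expProd_gauge hr (hgauge s hs)).comp hl
  have t6 := (tendsto_expProd_gauge hr (hgauge (r - s) hrs)).comp hl
  have t7 := (tendsto_expProd_rho hr h1 h2).comp hl
  have e0 : Real.pi * x / r = I * β / r := by rw [hx]; field_simp
  rw [exr, e0, mul_one] at t1
  rw [exr, mul_one] at t2
  rw [exr] at t3
  rw [es1, es2, sin_pi_sub, sin_pi_sub] at t4
  have key := tendsto_faceMatrix ((hpow (-(1 / 2))).mul t7) ((hq1.mul t6).mul t1) (t3.mul t2)
    ((hpow (2 * x)).mul (t4.mul t2)) ((hq1.mul t5).mul t1)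
  simp only [one_mul] at key
  refine key.congr' ?_
  filter_upwards [Ioo_mem_nhdsLT (zero_lt_one (α := ℝ))] with q hq
  have hq2 : (q : ℂ) ^ 2 = exp (-(1 * ((-2 * Real.log q : ℝ) : ℂ))) := by
    rw [← hscale q hq.1, mul_one, cpow_ofNat]
  rw [show 2 * I * β / Real.pi = 2 * x by rw [hx]; ring, hscale q hq.1, hscale q hq.1,
    hscale q hq.1, ellipticR_cexp _ _ _ _ _ hq2]
  rfl

end DynYangian

end

open Complex DynYangian in
theorem mainTheorem1 (r : ℂ) (hr : 0 < r.re) :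
    (∀ β s : ℂ,
      sin ((Real.pi + I * β) / r) ≠ 0 →
      sin (Real.pi * s / r) ≠ 0 →
      (∀ m n : ℕ, I * β / Real.pi + m * r + n * 2 ≠ 0) →
      (∀ m n : ℕ, r + 1 - I * β / Real.pi + m * r + n * 2 ≠ 0) →
      Tendsto
        (fun q : ℝ => ellipticR (q : ℂ) ((q : ℂ) ^ (2 * I * β / Real.pi))
          ((q : ℂ) ^ (2 * r)) ((q : ℂ) ^ (2 * s)))
        (𝓝[<] 1) (𝓝 (dynR β r s))) ∧
    (∀ β : ℂ,
      sin (I * β) ≠ 0 →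
      (∀ m n : ℕ, I * β / Real.pi + m * r + n * 2 ≠ 0) →
      (∀ m n : ℕ, r + 1 - I * β / Real.pi + m * r + n * 2 ≠ 0) →
      rho β r = rhoV8 β r) ∧
    (∀ β β' s : ℂ,
      sin ((Real.pi + I * β) / r) ≠ 0 →
      sin ((Real.pi + I * β') / r) ≠ 0 →
      sin ((Real.pi + I * (β + β')) / r) ≠ 0 →
      sin (Real.pi * s / r) ≠ 0 →
      sin (Real.pi * (s + 1) / r) ≠ 0 →
      sin (Real.pi * (s - 1) / r) ≠ 0 →
      DynYangBaxter (fun β s => dynR β r s) β β' s) := by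
  exact ⟨fun β s hβ hs h1 h2 => tendsto_ellipticR hr hβ hs h1 h2,
    fun β hβ _ _ => rho_eq_rhoV8 hr hβ,
    fun β β' s hβ hβ' hββ' hs hsp hsm => dynYangBaxter_dynR hr hβ hβ' hββ' hs hsp hsm⟩
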